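/- **Setting.** Let $d\ge 1$ and let $\Gamma$ be a set of decorations. A *tile* is a pair $(a,c)$ with $c\in\Gamma$ and $a\subset\mathbb R^d$ homeomorphic to the closed unit ball (undecorated tiles: $\Gamma$ is one point). A *pattern* (*tiling*) is a finite set of tiles (a set of tiles whose union is $\mathbb R^d$) in which different tiles have disjoint interiors. We identify a tile with its underlying set $a$ when speaking of points and distances. For a pattern $M$ let $s(M)$ be the union of its tiles, let $r_{\rm in}(M)$ be the largest radius of a closed ball contained in $s(M)$, and let $r_{\rm out}(M)$ be the smallest radius of a closed ball containing $s(M)$. A pattern class is a pattern up to translation (translations keep decorations). For pattern classes $P,Q$ we write $P\subset Q$ if some representative of $P$ is contained in some representative of $Q$. For a tiling $T$ let $\mathcal P(T)$ be the set of classes of the patterns contained in $T$. A set $\mathcal P$ of pattern classes is *admissible* if (i) $P\in\mathcal P$ and $Q\subset P$ imply $Q\in\mathcal P$; (ii) there are $0<r_{\min},r_{\max}<\infty$ with $r_{\min}\le r_{\rm in}(a)\le r_{\rm out}(a)\le r_{\max}$ for all tiles $a$ occurring in $\mathcal P$; (iii) if $M$ represents an element of $\mathcal P$, $0\in s(M)$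 and $r>0$, then there is a representative $N\supset M$ of an element of $\mathcal P$ such that $s(N)$ contains the closed ball of radius $r$ around $0$. An admissible $\mathcal P$ is *linearly repetitive* if there is $c>0$ such that every $P\in\mathcal P$ with $r_{\rm out}(P)\ge 1$ is contained in every $Q\in\mathcal P$ with $r_{\rm in}(Q)\ge c\, r_{\rm out}(P)$. A tiling $T$ is linearly repetitive if $\mathcal P(T)$ is admissible and linearly repetitive. Let $\Omega(T)$ be the set of all tilings $S$ with $\mathcal P(S)\subset\mathcal P(T)$. Let $T$ be a linearly repetitive tiling and let $A$ be a self-adjoint bounded operator on $\ell^2(T)$ with matrix elements $A(x,y)$, $x,y\in T$. Assume that for some $R\ge 0$: * (FR) $A(x,y)=0$ whenever $\operatorname{dist}(x,y)\ge R$; * (I) $A(x,y)$ depends only on the class of the patch $\{t\in T:\operatorname{dist}(t,\{x,y\})\le R\}$ with its distinguished tiles $x,y$, that is, $A(x,y)=A(x',y')$ whenever some translation maps $x$ to $x'$, $y$ to $y'$ and the patch of $(x,y)$ onto the patch of $(x',y')$. For $S\in\Omega(T)$ let $A(S)$ be the operator on $\ell^2(S)$ whose matrix element at $(x,y)$ is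 $A(x',y')$ for any $x',y'\in T$ such that some translation maps $x$ to $x'$, $y$ to $y'$ and the patch of $(x,y)$ in $S$ onto the patch of $(x',y')$ in $T$. For a box $B=\prod_{j=1}^d[a_j,b_j]$ with $a_j<b_j$ let $|B|$ be its volume and $\omega(B)=\min_j(b_j-a_j)$. Let $A(S)|_B$ be the finite matrix $(A(S)(x,y))_{x,y}$ indexed by the tiles $x,y\in S$ that meet the interior of $B$, and for $\lambda\in\mathbb R$ put $$k^S_\lambda(B)=\frac{1}{|B|}\,\#\{\text{eigenvalues of }A(S)|_B\text{ that are}\le\lambda\},$$ where eigenvalues are counted with multiplicity. **Theorem.** For every $\lambda\in\mathbb R$ the limit $\lim_{\omega(B)\to\infty}k^S_\lambda(B)$ exists for each $S\in\Omega(T)$, is independent of $S$, and the convergence is uniform in $S$: there is $N(\lambda)\in\mathbb R$ such that for every $\varepsilon>0$ there is $r>0$ with $|k^S_\lambda(B)-N(\lambda)|<\varepsilon$ for all $S\in\Omega(T)$ and all boxes $B$ with $\omega(B)\ge r$. -/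

import Mathlib

noncomputable section

namespace LRTiling

/-- Euclidean space of dimension `d`. -/
abbrev Space (d : ℕ) : Type := EuclideanSpace ℝ (Fin d)

/-- A subset of `ℝ^d` together with a decoration from `Γ` (undecorated tiles: `Γ` a point). -/
abbrev Tile (d : ℕ) (Γ : Type*) : Type _ := Set (Space d) × Γ

variable {d : ℕ} {Γ : Type*}

/-- The translate `m + t` of a decorated tile; the decoration is kept. -/
def Tile.shift (t : Space d) (m : Tile d Γ) : Tile d Γ := ((fun p => p + t) '' m.1, m.2)

/-- The translate `M + t` of a set of tiles. -/
def shiftSet (t : Space d) (M : Set (Tile d Γ)) : Set (Tile d Γ) := Tile.shift t '' M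

/-- The underlying set `s(M)`. -/
def support (M : Set (Tile d Γ)) : Set (Space d) := ⋃ m ∈ M, m.1

/-- Every tile is homeomorphic to the closed unit ball, and different tiles are disjoint up to
their boundaries. In particular every underlying set carries only one decoration. -/
def IsTileFamily (M : Set (Tile d Γ)) : Prop :=
  (∀ m ∈ M, Nonempty (m.1 ≃ₜ Metric.closedBall (0 : Space d) 1)) ∧
    M.Pairwise fun m n => Disjoint (interior m.1) (interior n.1)

/-- A pattern is a finite family of tiles. -/
def IsPattern (M : Set (Tile d Γ)) : Prop := M.Finite ∧ IsTileFamily M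

/-- A tiling is a family of tiles that covers the whole space. -/
def IsTiling (T : Set (Tile d Γ)) : Prop := IsTileFamily T ∧ support T = Set.univ

/-- The type of (decorated) patterns. -/
abbrev Pattern (d : ℕ) (Γ : Type*) : Type _ := {M : Set (Tile d Γ) // IsPattern M}

theorem shiftSet_zero (M : Set (Tile d Γ)) : shiftSet 0 M = M := by
  have h : (Tile.shift (0 : Space d) : Tile d Γ → Tile d Γ) = id := by
    funext m; simp [Tile.shift]
  simp [shiftSet, h]

theorem shiftSet_shiftSet (t u : Space d) (M : Set (Tile d Γ)) :
    shiftSet u (shiftSet t M) = shiftSet (t + u) M := by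
  simp only [shiftSet, Set.image_image]
  congr 1
  funext m
  rw [Tile.shift, Tile.shift, Tile.shift, Set.image_image]
  simp only [add_assoc]

/-- Two patterns are equivalent if they agree up to a translation. -/
instance patternSetoid (d : ℕ) (Γ : Type*) : Setoid (Pattern d Γ) where
  r M N := ∃ t : Space d, shiftSet t M.1 = N.1
  iseqv :=
    { refl := fun M => ⟨0, shiftSet_zero M.1⟩
      symm := by
        rintro M N ⟨t, h⟩
        exact ⟨-t, by rw [← h, shiftSet_shiftSet, add_neg_cancel, shiftSet_zero]⟩
      trans := by
        rintro M N K ⟨t, h⟩ ⟨u, k⟩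
        exact ⟨t + u, by rw [← k, ← h, shiftSet_shiftSet]⟩ }

/-- Abstract patterns (pattern classes): patterns up to translation. -/
abbrev AbstractPattern (d : ℕ) (Γ : Type*) : Type _ := Quotient (patternSetoid d Γ)

/-- `P ⊂ Q` for abstract patterns. -/
def AbstractPattern.Contained (P Q : AbstractPattern d Γ) : Prop :=
  ∃ M N : Pattern d Γ, ⟦M⟧ = P ∧ ⟦N⟧ = Q ∧ M.1 ⊆ N.1

/-- The largest radius of a closed ball contained in `K`. -/
def innerRadius (K : Set (Space d)) : ℝ := sSup {r | ∃ x, Metric.closedBall x r ⊆ K}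

/-- The smallest radius of a closed ball containing `K`. -/
def outerRadius (K : Set (Space d)) : ℝ := sInf {r | ∃ x, K ⊆ Metric.closedBall x r}

/-- Admissible sets of abstract patterns. -/
structure IsAdmissible (Ps : Set (AbstractPattern d Γ)) : Prop where
  mem_of_contained : ∀ P ∈ Ps, ∀ Q : AbstractPattern d Γ, Q.Contained P → Q ∈ Ps
  radii : ∃ rmin rmax : ℝ, 0 < rmin ∧ 0 < rmax ∧
    ∀ M : Pattern d Γ, ⟦M⟧ ∈ Ps → ∀ m ∈ M.1,
      rmin ≤ innerRadius m.1 ∧ innerRadius m.1 ≤ outerRadius m.1 ∧ outerRadius m.1 ≤ rmax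
  extend : ∀ M : Pattern d Γ, ⟦M⟧ ∈ Ps → (0 : Space d) ∈ support M.1 → ∀ r : ℝ, 0 < r →
    ∃ N : Pattern d Γ, ⟦N⟧ ∈ Ps ∧ Metric.closedBall (0 : Space d) r ⊆ support N.1 ∧ M.1 ⊆ N.1

/-- Linear repetitivity of a set of abstract patterns; the radii of an abstract pattern are those
of any representative. -/
def IsLinearlyRepetitive (Ps : Set (AbstractPattern d Γ)) : Prop :=
  IsAdmissible Ps ∧ ∃ c : ℝ, 0 < c ∧
    ∀ M N : Pattern d Γ, ⟦M⟧ ∈ Ps → ⟦N⟧ ∈ Ps → 1 ≤ outerRadius (support M.1) →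
      c * outerRadius (support M.1) ≤ innerRadius (support N.1) →
        AbstractPattern.Contained (⟦M⟧ : AbstractPattern d Γ) ⟦N⟧

/-- The set `P(T)` of classes of the (finite) subpatterns of `T`. -/
def patternClasses (T : Set (Tile d Γ)) : Set (AbstractPattern d Γ) :=
  {P | ∃ M : Pattern d Γ, M.1 ⊆ T ∧ ⟦M⟧ = P}

/-- The set `Ω(Ps)` of all tilings associated to `Ps`. -/
def tilingSpace (Ps : Set (AbstractPattern d Γ)) : Set (Set (Tile d Γ)) :=
  {S | IsTiling S ∧ patternClasses S ⊆ Ps}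

/-- The (Euclidean) distance of two tiles. -/
def tileDist (x y : Tile d Γ) : ℝ := sInf (Set.image2 dist x.1 y.1)

/-- The pattern `{t ∈ T : dist(t, {x, y}) ≤ R}`. -/
def patch (R : ℝ) (T : Set (Tile d Γ)) (x y : Tile d Γ) : Set (Tile d Γ) :=
  {t ∈ T | tileDist t x ≤ R ∨ tileDist t y ≤ R}

/-- The `R`-patches of the pair `(x, y)` in `S` and of the pair `(x', y')` in `T` have the same
class: some translation maps the first patch onto the second one, `x` to `x'` and `y` to `y'`. -/
def SamePatch (R : ℝ) (S T : Set (Tile d Γ)) (x y x' y' : Tile d Γ) : Prop :=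
  ∃ t : Space d, x.shift t = x' ∧ y.shift t = y' ∧ shiftSet t (patch R S x y) = patch R T x' y'

/-- The Hilbert space `ℓ²(T)`. -/
abbrev L2 (T : Set (Tile d Γ)) : Type _ := lp (fun _ : T => ℂ) 2

open Classical in
/-- The matrix element `A(x, y) = ⟨δ_x, A δ_y⟩`. -/
def matrixElement {T : Set (Tile d Γ)} (A : L2 T →L[ℂ] L2 T) (x y : T) : ℂ :=
  inner ℂ (lp.single 2 x (1 : ℂ) : L2 T) (A (lp.single 2 y (1 : ℂ)))

/-- The finite range property. -/
def FiniteRange {T : Set (Tile d Γ)} (A : L2 T →L[ℂ] L2 T) (R : ℝ) : Prop :=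
  ∀ x y : T, R ≤ tileDist x.1 y.1 → matrixElement A x y = 0

/-- The invariance property: `A(x, y)` depends only on the class of the `R`-patch of `(x, y)`. -/
def PatternInvariant {T : Set (Tile d Γ)} (A : L2 T →L[ℂ] L2 T) (R : ℝ) : Prop :=
  ∀ x y x' y' : T, SamePatch R T T x.1 y.1 x'.1 y'.1 →
    matrixElement A x y = matrixElement A x' y'

open Classical in
/-- The matrix elements of the manifestation `A(S)` on `ℓ²(S)` of the pattern-invariant operator
`A` on `ℓ²(T)`: the value at `(x, y)` is `A(x', y')` for any pair `(x', y')` in `T` with the same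
`R`-patch. Such a pair exists if `S ∈ Ω(P(T))`; the value `0` otherwise is immaterial. -/
def manifestation {T : Set (Tile d Γ)} (A : L2 T →L[ℂ] L2 T) (R : ℝ) (S : Set (Tile d Γ))
    (x y : S) : ℂ :=
  if h : ∃ p : T × T, SamePatch R S T x.1 y.1 p.1.1 p.2.1 then
    matrixElement A h.choose.1 h.choose.2
  else 0

/-- Boxes with sides parallel to the coordinate axes. -/
structure Box (d : ℕ) where
  lower : Fin d → ℝ
  upper : Fin d → ℝ
  lower_lt_upper : ∀ j, lower j < upper j

/-- The box as a subset of `ℝ^d`. -/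
def Box.toSet (B : Box d) : Set (Space d) := {x | ∀ j, B.lower j ≤ x j ∧ x j ≤ B.upper j}

/-- The volume `|B|`. -/
def Box.vol (B : Box d) : ℝ := ∏ j, (B.upper j - B.lower j)

/-- The width `ω(B)`, the smallest side length. -/
def Box.width (B : Box d) : ℝ := ⨅ j, (B.upper j - B.lower j)

/-- The index set of `S ∩ B`: the tiles `x` of `S` that meet the interior of `B`. Such a tile is
determined by its piece `x ∩ B`. -/
abbrev BoxTiles (S : Set (Tile d Γ)) (B : Box d) : Type _ :=
  {x : S // (x.1.1 ∩ interior B.toSet).Nonempty}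

/-- The restriction to `B` of an operator on `ℓ²(S)` with matrix elements `a`. -/
def boxRestriction {S : Set (Tile d Γ)} (a : S → S → ℂ) (B : Box d) :
    Matrix (BoxTiles S B) (BoxTiles S B) ℂ :=
  Matrix.of fun x y => a x.1 y.1

open Classical in
/-- The number of eigenvalues `≤ lam`, counted with multiplicity, of a matrix with real
eigenvalues and a finite index set. -/
def eigenvalueCount {ι : Type*} (M : Matrix ι ι ℂ) (lam : ℝ) : ℕ :=
  if _h : Finite ι then
    letI : Fintype ι := Fintype.ofFinite ι
    M.charpoly.roots.countP fun z => z.re ≤ lam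
  else 0

/-- The normalized eigenvalue counting function of `A(S)|_B`. -/
def countingFunction {T : Set (Tile d Γ)} (A : L2 T →L[ℂ] L2 T) (R : ℝ) (lam : ℝ)
    (S : Set (Tile d Γ)) (B : Box d) : ℝ :=
  (1 / B.vol) * (eigenvalueCount (boxRestriction (manifestation A R S) B) lam : ℝ)

end LRTiling

end

/-! For fixed `lam`, let F(S, B) be the number of eigenvalues at most `lam` of A(S)|_B. The limit
exists because F is additive up to surface terms and because linear repetitivity puts copies of
every box pattern, at bounded proportion, into all larger boxes.

Almost additivity: when a hyperplane cuts B, the tiles away from it form two families decoupled by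
the finite range. Deleting one index from a Hermitian matrix changes the eigenvalue count by at most
one (`kernelCount_mono`, `kernelCount_le_add`), and the tiles near the hyperplane number at most a
constant times the area of the cut by a volume count. This is `abs_kernelCount_cut_le`.

Repetition: F(S, B) depends only on the tiles of S near B, up to translation
(`kernelCount_translate`), and by `exists_copy_inside` the pattern near a box with sides in [L, 2L)
recurs deep inside every box of width at least KL, in every tiling of the space.

Averaging (`exists_uniform_mean`): adding or subtracting a multiple of the surface makes F
subadditive or superadditive. Let α be the least asymptotic upper bound of the first density and β
the greatest asymptotic lower bound of the second, both uniform over all tilings. If β < α, some box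
of large size has density close to β. A copy of it fills a fixed fraction of every box of a larger
scale, and the rest has density at most about α, so the upper bound drops strictly below α. Hence α
= β, which is the uniform limit. -/

noncomputable section

namespace LRTiling

variable {d : ℕ}

/-! ### Boxes: volume, surface and cuts by coordinate hyperplanes. -/

namespace Box

@[ext]
theorem ext_bounds {B B' : Box d} (hl : ∀ j, B.lower j = B'.lower j)
    (hu : ∀ j, B.upper j = B'.upper j) : B = B' := by
  cases B; cases B'
  simp only [mk.injEq]
  exact ⟨funext hl, funext hu⟩

/-- The length of the box in the direction `j`. -/
def side (B : Box d) (j : Fin d) : ℝ := B.upper j - B.lower j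

theorem side_pos (B : Box d) (j : Fin d) : 0 < B.side j := sub_pos.2 (B.lower_lt_upper j)

theorem vol_eq (B : Box d) : B.vol = ∏ j, B.side j := rfl

theorem vol_pos (B : Box d) : 0 < B.vol := Finset.prod_pos fun j _ => B.side_pos j

/-- The box with the `j`-th factor replaced by `[a, b]`. -/
def withFactor (B : Box d) (j : Fin d) (a b : ℝ) (h : a < b) : Box d where
  lower := Function.update B.lower j a
  upper := Function.update B.upper j b
  lower_lt_upper i := by
    rcases eq_or_ne i j with rfl | hi
    · simpa using h
    · simpa [hi] using B.lower_lt_upper i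

theorem side_withFactor (B : Box d) (j : Fin d) (a b : ℝ) (h : a < b) :
    (B.withFactor j a b h).side = Function.update B.side j (b - a) := by
  funext i
  rcases eq_or_ne i j with rfl | hi
  · simp [side, withFactor]
  · simp [side, withFactor, hi]

/-- The area of the face orthogonal to the direction `j`. -/
def face (B : Box d) (j : Fin d) : ℝ := ∏ i ∈ Finset.univ.erase j, B.side i

/-- Half the surface area of the box. -/
def surface (B : Box d) : ℝ := ∑ j, B.face j

theorem face_pos (B : Box d) (j : Fin d) : 0 < B.face j :=
  Finset.prod_pos fun i _ => B.side_pos i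

theorem surface_nonneg (B : Box d) : 0 ≤ B.surface :=
  Finset.sum_nonneg fun j _ => (B.face_pos j).le

theorem side_mul_face (B : Box d) (j : Fin d) : B.side j * B.face j = B.vol :=
  Finset.mul_prod_erase _ _ (Finset.mem_univ j)

theorem face_withFactor_self (B : Box d) (j : Fin d) (a b : ℝ) (h : a < b) :
    (B.withFactor j a b h).face j = B.face j := by
  refine Finset.prod_congr rfl fun i hi => ?_
  rw [side_withFactor, Function.update_of_ne (Finset.ne_of_mem_erase hi)]

theorem vol_withFactor (B : Box d) (j : Fin d) (a b : ℝ) (h : a < b) :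
    (B.withFactor j a b h).vol = (b - a) * B.face j := by
  rw [← side_mul_face _ j, face_withFactor_self, side_withFactor, Function.update_self]

theorem face_withFactor_of_ne (B : Box d) {i j : Fin d} (hij : i ≠ j) (a b : ℝ) (h : a < b) :
    (B.withFactor j a b h).face i =
      (b - a) * ∏ k ∈ (Finset.univ.erase i).erase j, B.side k := by
  have hj : j ∈ Finset.univ.erase i := by simp [hij.symm]
  rw [face, ← Finset.mul_prod_erase _ _ hj, side_withFactor, Function.update_self]
  congr 1
  refine Finset.prod_congr rfl fun k hk => ?_
  rw [Function.update_of_ne (Finset.ne_of_mem_erase hk)]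

theorem vol_cut (B : Box d) (j : Fin d) (c : ℝ) (h₁ : B.lower j < c) (h₂ : c < B.upper j) :
    B.vol = (B.withFactor j _ _ h₁).vol + (B.withFactor j _ _ h₂).vol := by
  rw [vol_withFactor, vol_withFactor, ← B.side_mul_face j, side]
  ring

/-- Faces orthogonal to the other directions are divided by the cut, while the face orthogonal to
`j` occurs in both pieces. The surplus lets a multiple of the surface absorb the error of one cut,
which is proportional to `B.face j`. -/
theorem surface_cut (B : Box d) (j : Fin d) (c : ℝ) (h₁ : B.lower j < c) (h₂ : c < B.upper j) :
    (B.withFactor j _ _ h₁).surface + (B.withFactor j _ _ h₂).surface =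
      B.surface + B.face j := by
  simp only [surface]
  rw [← Finset.add_sum_erase _ _ (Finset.mem_univ j),
    ← Finset.add_sum_erase _ (B.withFactor j _ _ h₂).face (Finset.mem_univ j),
    ← Finset.add_sum_erase _ B.face (Finset.mem_univ j), face_withFactor_self,
    face_withFactor_self]
  have : ∑ i ∈ Finset.univ.erase j, B.face i =
      ∑ i ∈ Finset.univ.erase j, (B.withFactor j _ _ h₁).face i +
        ∑ i ∈ Finset.univ.erase j, (B.withFactor j _ _ h₂).face i := by
    rw [← Finset.sum_add_distrib]
    refine Finset.sum_congr rfl fun i hi => ?_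
    have hij := Finset.ne_of_mem_erase hi
    have hj : j ∈ Finset.univ.erase i := by simp [hij.symm]
    rw [face_withFactor_of_ne B hij, face_withFactor_of_ne B hij, face,
      ← Finset.mul_prod_erase _ _ hj, side]
    ring
  rw [this]
  ring

theorem surface_le (B : Box d) {L : ℝ} (hL : 0 < L) (h : ∀ j, L ≤ B.side j) :
    B.surface ≤ d / L * B.vol := by
  have : ∀ j ∈ Finset.univ, B.face j ≤ B.vol / L := fun j _ => by
    rw [le_div_iff₀ hL, ← B.side_mul_face j, mul_comm]
    exact mul_le_mul_of_nonneg_right (h j) (B.face_pos j).le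
  refine (Finset.sum_le_sum this).trans_eq ?_
  simp only [Finset.sum_const, Finset.card_univ, Fintype.card_fin, nsmul_eq_mul]
  ring

theorem surface_congr {B B' : Box d} (h : ∀ j, B.side j = B'.side j) : B.surface = B'.surface := by
  simp only [surface, face, h]

theorem vol_congr {B B' : Box d} (h : ∀ j, B.side j = B'.side j) : B.vol = B'.vol := by
  simp only [vol_eq, h]

theorem sum_side_withFactor (B : Box d) (j : Fin d) (a b : ℝ) (h : a < b) :
    ∑ i, (B.withFactor j a b h).side i = ∑ i, B.side i - B.side j + (b - a) := by
  rw [side_withFactor, Finset.sum_update_of_mem (Finset.mem_univ j),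
    ← Finset.add_sum_erase _ B.side (Finset.mem_univ j), Finset.sdiff_singleton_eq_erase]
  ring

theorem le_side_withFactor (B : Box d) (j : Fin d) {a b L : ℝ} (h : a < b) (hab : L ≤ b - a)
    (hB : ∀ i, L ≤ B.side i) (i : Fin d) : L ≤ (B.withFactor j a b h).side i := by
  rw [side_withFactor]
  rcases eq_or_ne i j with rfl | hi
  · simpa using hab
  · simpa [hi] using hB i

end Box

/-! ### Means of almost additive box functions. -/

/-- Subadditivity under cuts by a coordinate hyperplane into boxes of width at least one. -/
def CutSubadditive (G : Box d → ℝ) : Prop :=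
  ∀ (B : Box d) (j : Fin d) (c : ℝ) (h₁ : B.lower j < c) (h₂ : c < B.upper j),
    (∀ i, 1 ≤ (B.withFactor j _ _ h₁).side i) → (∀ i, 1 ≤ (B.withFactor j _ _ h₂).side i) →
      G B ≤ G (B.withFactor j _ _ h₁) + G (B.withFactor j _ _ h₂)

/-- An upper bound for boxes with all sides in `[L, 2L)` extends to boxes of width at least `L`. -/
theorem CutSubadditive.le_of_forall_small {G : Box d → ℝ} (hG : CutSubadditive G) {L a : ℝ}
    (hL : 1 ≤ L) (h : ∀ B : Box d, (∀ j, L ≤ B.side j ∧ B.side j < 2 * L) → G B ≤ a * B.vol)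
    (B : Box d) (hB : ∀ j, L ≤ B.side j) : G B ≤ a * B.vol := by
  -- Induction measure: halving a side of length at least `2 * L` lowers the sum of the sides by at
  -- least `L`.
  obtain ⟨n, hn⟩ : ∃ n : ℕ, ∑ j, B.side j ≤ n * L := by
    obtain ⟨n, hn⟩ := exists_nat_ge ((∑ j, B.side j) / L)
    exact ⟨n, (div_le_iff₀ (by linarith)).1 hn⟩
  induction n generalizing B with
  | zero =>
    refine h B fun j => absurd (Finset.single_le_sum (fun i _ => (B.side_pos i).le)
      (Finset.mem_univ j)) ?_
    have := hB j
    simp only [CharP.cast_eq_zero, zero_mul] at hn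
    linarith
  | succ n ih =>
    by_cases hs : ∀ j, B.side j < 2 * L
    · exact h B fun j => ⟨hB j, hs j⟩
    push Not at hs
    obtain ⟨j, hj⟩ := hs
    have hside : B.side j = B.upper j - B.lower j := rfl
    have h₁ : B.lower j < (B.lower j + B.upper j) / 2 := by linarith [B.lower_lt_upper j]
    have h₂ : (B.lower j + B.upper j) / 2 < B.upper j := by linarith [B.lower_lt_upper j]
    have k₁ := B.le_side_withFactor j h₁ (by linarith) hB
    have k₂ := B.le_side_withFactor j h₂ (by linarith) hB
    push_cast at hn
    have i₁ := ih _ k₁ (by rw [B.sum_side_withFactor]; linarith)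
    have i₂ := ih _ k₂ (by rw [B.sum_side_withFactor]; linarith)
    have := hG B j _ h₁ h₂ (fun i => hL.trans (k₁ i)) fun i => hL.trans (k₂ i)
    rw [B.vol_cut j _ h₁ h₂]
    linarith

/-- Comparison of a box with a box deep inside of it. -/
theorem CutSubadditive.le_add_of_inside {G : Box d → ℝ} (hG : CutSubadditive G) {L a : ℝ}
    (hL : 1 ≤ L) (h : ∀ B : Box d, (∀ j, L ≤ B.side j) → G B ≤ a * B.vol)
    (B B' : Box d) (hB' : ∀ j, L ≤ B'.side j) (hl : ∀ j, B.lower j + L ≤ B'.lower j)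
    (hu : ∀ j, B'.upper j + L ≤ B.upper j) : G B ≤ G B' + a * (B.vol - B'.vol) := by
  -- Induction on the set of directions in which the two boxes differ. Each direction costs two
  -- cuts, which remove one slab on either side of `B'`.
  suffices H : ∀ (s : Finset (Fin d)) (B : Box d),
      (∀ j ∈ s, B.lower j + L ≤ B'.lower j ∧ B'.upper j + L ≤ B.upper j) →
      (∀ j ∉ s, B.lower j = B'.lower j ∧ B.upper j = B'.upper j) →
      G B ≤ G B' + a * (B.vol - B'.vol) from
    H Finset.univ B (fun j _ => ⟨hl j, hu j⟩) fun j hj => absurd (Finset.mem_univ j) hj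
  intro s
  induction s using Finset.induction_on with
  | empty =>
    intro B _ hB
    have : B = B' := Box.ext_bounds (fun j => (hB j (by simp)).1) fun j => (hB j (by simp)).2
    simp [this]
  | insert j s hj ih =>
    intro B hs hns
    have hsB : ∀ i, L ≤ B.side i := fun i => by
      have := hB' i
      rw [Box.side] at this ⊢
      by_cases hi : i ∈ insert j s
      · have := hs i hi; linarith
      · have := hns i hi; linarith
    obtain ⟨hjl, hju⟩ := hs j (Finset.mem_insert_self _ _)
    have hj' := hB' j
    have hlu := B'.lower_lt_upper j
    rw [Box.side] at hj'
    -- The gap of `L` between the boxes makes both slabs wide enough for the density bound `h`; `C`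
    -- is what remains after the lower slab is removed.
    have h₁ : B.lower j < B'.lower j := by linarith
    have h₂ : B'.lower j < B.upper j := by linarith
    have k₁ := B.le_side_withFactor j h₁ (by linarith) hsB
    have k₂ := B.le_side_withFactor j h₂ (by linarith) hsB
    set C := B.withFactor j _ _ h₂ with hC
    have hCl : C.lower j = B'.lower j := by simp [hC, Box.withFactor]
    have hCu : C.upper j = B.upper j := by simp [hC, Box.withFactor]
    have h₃ : C.lower j < B'.upper j := by linarith
    have h₄ : B'.upper j < C.upper j := by linarith
    have k₃ := C.le_side_withFactor j h₃ (by linarith) k₂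
    have k₄ := C.le_side_withFactor j h₄ (by linarith) k₂
    have e₁ := hG B j _ h₁ h₂ (fun i => hL.trans (k₁ i)) fun i => hL.trans (k₂ i)
    have e₂ := hG C j _ h₃ h₄ (fun i => hL.trans (k₃ i)) fun i => hL.trans (k₄ i)
    have v₁ := B.vol_cut j _ h₁ h₂
    have v₂ := C.vol_cut j _ h₃ h₄
    have b₁ := h _ k₁
    have b₂ := h _ k₄
    have := ih (C.withFactor j _ _ h₃)
      (fun i hi => by
        have hij : i ≠ j := fun e => hj (e ▸ hi)
        simpa [hC, Box.withFactor, hij] using hs i (Finset.mem_insert_of_mem hi))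
      (fun i hi => by
        rcases eq_or_ne i j with rfl | hij
        · simp [hC, Box.withFactor]
        · simpa [hC, Box.withFactor, hij] using hns i (by simp [hij, hi]))
    rw [← hC] at e₁ v₁
    rw [v₁, v₂]
    linarith

/-- Uniform existence of the means of an almost additive box function which is linearly
repetitive. -/
theorem exists_uniform_mean {σ : Type*} {Ω : Set σ} (hΩ : Ω.Nonempty) (F : σ → Box d → ℝ)
    {C₀ C K L₀ : ℝ} (hC : 0 ≤ C) (hK : 1 ≤ K)
    (hnonneg : ∀ s ∈ Ω, ∀ B : Box d, 0 ≤ F s B)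
    (hbound : ∀ s ∈ Ω, ∀ B : Box d, (∀ j, 1 ≤ B.side j) → F s B ≤ C₀ * B.vol)
    (hcut : ∀ s ∈ Ω, ∀ (B : Box d) (j : Fin d) (c : ℝ) (h₁ : B.lower j < c) (h₂ : c < B.upper j),
      (∀ i, 1 ≤ B.side i) →
        |F s B - (F s (B.withFactor j _ _ h₁) + F s (B.withFactor j _ _ h₂))| ≤ C * B.face j)
    (hrep : ∀ L, L₀ ≤ L → ∀ s₀ ∈ Ω, ∀ B₀ : Box d, (∀ j, L ≤ B₀.side j ∧ B₀.side j < 2 * L) →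
      ∀ s ∈ Ω, ∀ B : Box d, (∀ j, K * L ≤ B.side j) →
        ∃ B' : Box d, (∀ j, B'.side j = B₀.side j) ∧ (∀ j, B.lower j + L ≤ B'.lower j) ∧
          (∀ j, B'.upper j + L ≤ B.upper j) ∧ F s B' = F s₀ B₀) :
    ∃ N : ℝ, ∀ ε > 0, ∃ r : ℝ, ∀ s ∈ Ω, ∀ B : Box d, (∀ j, r ≤ B.side j) →
      |1 / B.vol * F s B - N| < ε := by
  obtain ⟨s₁, hs₁⟩ := hΩ
  let G : σ → Box d → ℝ := fun s B => F s B + C * B.surface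
  let H : σ → Box d → ℝ := fun s B => F s B - C * B.surface
  have le_cut : ∀ (B : Box d) (j : Fin d) (c : ℝ) (h₁ : B.lower j < c) (h₂ : c < B.upper j),
      (∀ i, 1 ≤ (B.withFactor j _ _ h₁).side i) → (∀ i, 1 ≤ (B.withFactor j _ _ h₂).side i) →
      ∀ i, 1 ≤ B.side i := by
    intro B j c h₁ h₂ k₁ k₂ i
    have k₁ := k₁ i
    have k₂ := k₂ i
    rw [Box.side_withFactor] at k₁ k₂
    rcases eq_or_ne i j with rfl | hi
    · simp only [Function.update_self] at k₁ k₂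
      rw [Box.side]; linarith
    · simpa [hi] using k₁
  have hG : ∀ s ∈ Ω, CutSubadditive (G s) := by
    intro s hs B j c h₁ h₂ k₁ k₂
    have e := abs_le.1 (hcut s hs B j c h₁ h₂ (le_cut B j c h₁ h₂ k₁ k₂))
    have := congrArg (C * ·) (B.surface_cut j c h₁ h₂)
    simp only [G]
    simp only [mul_add] at this
    linarith
  have hH : ∀ s ∈ Ω, CutSubadditive (fun B => -H s B) := by
    intro s hs B j c h₁ h₂ k₁ k₂
    have e := abs_le.1 (hcut s hs B j c h₁ h₂ (le_cut B j c h₁ h₂ k₁ k₂))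
    have := congrArg (C * ·) (B.surface_cut j c h₁ h₂)
    simp only [H]
    simp only [mul_add] at this
    linarith
  have hsurf : ∀ B : Box d, ∀ L, 0 < L → (∀ j, L ≤ B.side j) →
      C * B.surface ≤ C * d / L * B.vol := by
    intro B L hL hB
    calc C * B.surface ≤ C * (d / L * B.vol) :=
          mul_le_mul_of_nonneg_left (B.surface_le hL hB) hC
      _ = _ := by ring
  let U : Set ℝ := {a | ∃ L, 1 ≤ L ∧ ∀ s ∈ Ω, ∀ B : Box d, (∀ j, L ≤ B.side j) →
    G s B ≤ a * B.vol}
  let V : Set ℝ := {b | ∃ L, 1 ≤ L ∧ ∀ s ∈ Ω, ∀ B : Box d, (∀ j, L ≤ B.side j) →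
    b * B.vol ≤ H s B}
  have hU : U.Nonempty := by
    refine ⟨C₀ + C * d / 1, 1, le_rfl, fun s hs B hB => ?_⟩
    have := hsurf B 1 one_pos hB
    have := hbound s hs B hB
    simp only [G]
    linarith
  have hV : V.Nonempty := by
    refine ⟨-(C * d / 1), 1, le_rfl, fun s hs B hB => ?_⟩
    have := hsurf B 1 one_pos hB
    have := hnonneg s hs B
    simp only [H]
    linarith
  have hVU : ∀ b ∈ V, ∀ a ∈ U, b ≤ a := by
    rintro b ⟨L, hL, hb⟩ a ⟨L', hL', ha⟩
    -- A single cube that is large enough for both bounds compares them, since `H ≤ G`.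
    let B : Box d := ⟨fun _ => 0, fun _ => max L L', fun _ => lt_max_of_lt_left (by linarith)⟩
    have h₁ := hb s₁ hs₁ B fun j => by simp [Box.side, B]
    have h₂ := ha s₁ hs₁ B fun j => by simp [Box.side, B]
    have h₃ := mul_nonneg hC B.surface_nonneg
    refine le_of_mul_le_mul_right ?_ B.vol_pos
    simp only [G, H] at h₁ h₂
    linarith
  obtain ⟨a₁, ha₁⟩ := hU
  obtain ⟨b₁, hb₁⟩ := hV
  have hUbdd : BddBelow U := ⟨b₁, fun a ha => hVU b₁ hb₁ a ha⟩
  have hVbdd : BddAbove V := ⟨a₁, fun b hb => hVU b hb a₁ ha₁⟩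
  have key : sInf U ≤ sSup V := by
    by_contra! hlt
    set α := sInf U with hα
    set β := sSup V with hβ
    -- The fraction of volume that a box with sides at least `L` occupies in a box with sides below
    -- `2 * (K * L)`.
    set δ : ℝ := (1 / (2 * K)) ^ d with hδ
    have hδ0 : 0 < δ := by positivity
    have hδ1 : δ ≤ 1 := pow_le_one₀ (by positivity) (by rw [div_le_one (by linarith)]; linarith)
    -- Chosen so that the gain `δ * (α - β) = 4 * ε` outweighs the losses: less than `ε` from `a < α
    -- + ε` and at most `2 * ε` from the density `β + 2 * ε` of the copy.
    set ε := δ * (α - β) / 4 with hε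
    have hε0 : 0 < ε := by
      have := sub_pos.2 hlt
      positivity
    have hε1 : ε ≤ (α - β) / 4 := by
      rw [hε]
      have := mul_le_mul_of_nonneg_right hδ1 (sub_pos.2 hlt).le
      linarith
    obtain ⟨a, ⟨La, hLa, ha⟩, haε⟩ :=
      exists_lt_of_csInf_lt ⟨a₁, ha₁⟩ (show sInf U < α + ε by linarith)
    have hβV : β + ε ∉ V := fun h => by
      have := le_csSup hVbdd h
      linarith
    -- The last entry makes `G - H`, twice the surface term, at most `ε` times the volume.
    set L : ℝ := max (max La L₀) (2 * (C * d) / ε + 1) with hL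
    have hLa' : La ≤ L := (le_max_left _ _).trans (le_max_left _ _)
    have hL0 : L₀ ≤ L := (le_max_right _ _).trans (le_max_left _ _)
    have hL1 : 1 ≤ L := hLa.trans hLa'
    have hLpos : 0 < L := by linarith
    have hLε : 2 * (C * d / L) ≤ ε := by
      have : 2 * (C * d) / ε ≤ L := by
        have := le_max_right (max La L₀) (2 * (C * d) / ε + 1)
        linarith
      rw [div_le_iff₀ hε0] at this
      rw [← mul_div_assoc, div_le_iff₀ hLpos]
      linarith
    -- Without such a sparse box, superadditivity of `H` would carry the bound `β + ε` to all boxes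
    -- of width at least `L`, against the choice of `β`.
    have hex : ∃ s₀ ∈ Ω, ∃ B₀ : Box d, (∀ j, L ≤ B₀.side j ∧ B₀.side j < 2 * L) ∧
        H s₀ B₀ < (β + ε) * B₀.vol := by
      by_contra! hcon
      refine hβV ⟨L, hL1, fun s hs B hB => ?_⟩
      have := (hH s hs).le_of_forall_small (a := -(β + ε)) hL1
        (fun B hB => by have := hcon s hs B hB; linarith) B hB
      linarith
    obtain ⟨s₀, hs₀, B₀, hB₀, hHB₀⟩ := hex
    -- Every box of the scale `K * L` contains a copy of the sparse box. The copy has density at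
    -- most `β + 2 * ε` instead of `a ≥ α`, and subadditivity extends the improved bound to all
    -- larger boxes.
    have hnew : a - δ * (α - β - 2 * ε) ∈ U := by
      refine ⟨K * L, by nlinarith, fun s hs => ?_⟩
      refine (hG s hs).le_of_forall_small (by nlinarith) fun B hB => ?_
      obtain ⟨B', hside, hl, hu, hF⟩ := hrep L hL0 s₀ hs₀ B₀ hB₀ s hs B fun j => (hB j).1
      have h₁ := (hG s hs).le_add_of_inside hL1 (a := a)
        (fun B hB => ha s hs B fun j => hLa'.trans (hB j)) B B'
        (fun j => by rw [hside]; exact (hB₀ j).1) hl hu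
      have hvol := Box.vol_congr hside
      have hsf := Box.surface_congr hside
      have h₂ := hsurf B₀ L hLpos fun j => (hB₀ j).1
      have h₃ : G s B' ≤ (β + 2 * ε) * B₀.vol := by
        simp only [G, H] at hHB₀ ⊢
        rw [hF, hsf]
        have := mul_le_mul_of_nonneg_right hLε B₀.vol_pos.le
        linarith
      have h₄ : δ * B.vol ≤ B₀.vol := by
        rw [Box.vol_eq, Box.vol_eq, hδ]
        calc (1 / (2 * K)) ^ d * ∏ j, B.side j = ∏ j, (1 / (2 * K) * B.side j) := by
              rw [Finset.prod_mul_distrib]; simp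
          _ ≤ _ := by
              refine Finset.prod_le_prod (fun j _ => by have := B.side_pos j; positivity)
                fun j _ => ?_
              rw [one_div_mul_eq_div, div_le_iff₀ (by linarith)]
              have := (hB j).2
              have := mul_le_mul_of_nonneg_right (hB₀ j).1 (show 0 ≤ 2 * K by linarith)
              linarith
      have h₅ : 0 ≤ α - β - 2 * ε := by linarith
      have haα : α ≤ a := csInf_le hUbdd ⟨La, hLa, ha⟩
      have h₆ := mul_le_mul_of_nonneg_left h₄ h₅
      have h₇ := mul_le_mul_of_nonneg_right haα B₀.vol_pos.le
      rw [hvol] at h₁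
      linarith
    have h₁ := csInf_le hUbdd hnew
    have h₂ : δ * ε ≤ ε := by simpa using mul_le_mul_of_nonneg_right hδ1 hε0.le
    have h₃ : δ * (α - β) = 4 * ε := by rw [hε]; ring
    linarith
  refine ⟨sInf U, fun ε hε => ?_⟩
  obtain ⟨a, ⟨La, hLa, ha⟩, haε⟩ :=
    exists_lt_of_csInf_lt ⟨a₁, ha₁⟩ (show sInf U < sInf U + ε by linarith)
  obtain ⟨b, ⟨Lb, hLb, hb⟩, hbε⟩ :=
    exists_lt_of_lt_csSup ⟨b₁, hb₁⟩ (show sSup V - ε < sSup V by linarith)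
  refine ⟨max La Lb, fun s hs B hB => ?_⟩
  have h₁ := ha s hs B fun j => (le_max_left _ _).trans (hB j)
  have h₂ := hb s hs B fun j => (le_max_right _ _).trans (hB j)
  have h₃ := mul_nonneg hC B.surface_nonneg
  have hv := B.vol_pos
  simp only [G, H] at h₁ h₂
  have h₄ : 1 / B.vol * F s B ≤ a := by
    rw [one_div_mul_eq_div, div_le_iff₀ hv]; linarith
  have h₅ : b ≤ 1 / B.vol * F s B := by
    rw [one_div_mul_eq_div, le_div_iff₀ hv]; linarith
  rw [abs_lt]
  constructor <;> linarith

end LRTiling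
end

/-! ### Eigenvalue counts of Hermitian matrices under deletion of indices. -/

noncomputable section

namespace LRTiling

section Counting

open Matrix

variable {ι κ : Type*}

/-- The real part of the quadratic form of `M - lam`. -/
def shiftedForm [Fintype ι] (M : Matrix ι ι ℂ) (lam : ℝ) (v : ι → ℂ) : ℝ :=
  (star v ⬝ᵥ M *ᵥ v).re - lam * (star v ⬝ᵥ v).re

/-- Spectral theorem: the coordinates are those in the orthonormal eigenbasis, and the unitary
change of basis preserves the norm. -/
theorem exists_coordinates [Fintype ι] [DecidableEq ι] {M : Matrix ι ι ℂ} (hM : M.IsHermitian)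
    (lam : ℝ) : ∃ e : (ι → ℂ) ≃ₗ[ℂ] (ι → ℂ), ∀ v,
      shiftedForm M lam v = ∑ i, (hM.eigenvalues i - lam) * ‖e v i‖ ^ 2 := by
  set U : Matrix ι ι ℂ := (hM.eigenvectorUnitary : Matrix ι ι ℂ) with hU
  have h₁ : star U * U = 1 := Unitary.coe_star_mul_self _
  have h₂ : U * star U = 1 := Unitary.coe_mul_star_self _
  have hspec : M = U * diagonal (fun i => (hM.eigenvalues i : ℂ)) * star U := by
    conv_lhs => rw [hM.spectral_theorem, Unitary.conjStarAlgAut_apply]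
    rfl
  have hstar : ∀ v, star (star U *ᵥ v) = star v ᵥ* U := fun v => by
    rw [star_mulVec, star_eq_conjTranspose, conjTranspose_conjTranspose]
  refine ⟨LinearEquiv.ofLinearMap (toLin' (star U)) (toLin' U) ?_ ?_, fun v => ?_⟩
  · rw [← toLin'_mul, h₁, toLin'_one]
  · rw [← toLin'_mul, h₂, toLin'_one]
  simp only [LinearEquiv.coe_ofLinearMap, toLin'_apply]
  have hn : star v ⬝ᵥ v = star (star U *ᵥ v) ⬝ᵥ (star U *ᵥ v) := by
    rw [hstar, ← dotProduct_mulVec, mulVec_mulVec, h₂, one_mulVec]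
  have hq : star v ⬝ᵥ M *ᵥ v = star (star U *ᵥ v) ⬝ᵥ
      (diagonal (fun i => (hM.eigenvalues i : ℂ)) *ᵥ (star U *ᵥ v)) := by
    rw [hstar, ← dotProduct_mulVec, mulVec_mulVec, mulVec_mulVec, ← hspec]
  rw [shiftedForm, hq, hn]
  simp only [dotProduct, mulVec_diagonal, Pi.star_apply, Complex.re_sum]
  rw [Finset.mul_sum, ← Finset.sum_sub_distrib]
  refine Finset.sum_congr rfl fun i _ => ?_
  rw [Complex.star_def, Complex.sq_norm, Complex.normSq_apply]
  simp only [Complex.mul_re, Complex.conj_re, Complex.conj_im, Complex.ofReal_re,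
    Complex.ofReal_im, Complex.mul_im]
  ring

open Classical in
theorem eigenvalueCount_eq_countP [Fintype ι] [DecidableEq ι] (M : Matrix ι ι ℂ) (lam : ℝ) :
    eigenvalueCount M lam = M.charpoly.roots.countP fun z => z.re ≤ lam := by
  rw [eigenvalueCount, dif_pos (Finite.of_fintype ι)]
  congr!

theorem eigenvalueCount_eq_card [Fintype ι] [DecidableEq ι] {M : Matrix ι ι ℂ}
    (hM : M.IsHermitian) (lam : ℝ) :
    eigenvalueCount M lam = Fintype.card {i // hM.eigenvalues i ≤ lam} := by
  classical
  rw [eigenvalueCount_eq_countP, hM.roots_charpoly_eq_eigenvalues, Multiset.countP_map,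
    Fintype.card_subtype, Finset.card_def, Finset.filter_val]
  congr!

theorem extend_zero_injective {g : κ → ι} (hg : Function.Injective g) :
    Function.Injective (Function.ExtendByZero.linearMap ℂ g) := by
  intro v w h
  funext k
  simpa [Function.ExtendByZero.linearMap_apply, hg.extend_apply] using congrFun h (g k)

/-- A space on which the form is at most `lam` has dimension at most the number of eigenvalues
that are at most `lam`. -/
theorem finrank_le_eigenvalueCount [Fintype ι] {M : Matrix ι ι ℂ} (hM : M.IsHermitian) {lam : ℝ}
    {E : Type*} [AddCommGroup E] [Module ℂ E] (φ : E →ₗ[ℂ] (ι → ℂ)) (hφ : Function.Injective φ)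
    (h : ∀ v, shiftedForm M lam (φ v) ≤ 0) : Module.finrank ℂ E ≤ eigenvalueCount M lam := by
  classical
  obtain ⟨e, he⟩ := exists_coordinates hM lam
  rw [eigenvalueCount_eq_card hM]
  -- If the coordinates for eigenvalues at most `lam` vanish, the form is a sum of squares with
  -- positive coefficients. Being nonpositive, it forces the vector to be zero, so `p` is injective
  -- on the space.
  let p : (ι → ℂ) →ₗ[ℂ] ({i // hM.eigenvalues i ≤ lam} → ℂ) :=
    LinearMap.funLeft ℂ ℂ Subtype.val
  have hinj : Function.Injective (p ∘ₗ e.toLinearMap ∘ₗ φ) := by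
    rw [← LinearMap.ker_eq_bot, LinearMap.ker_eq_bot']
    intro v hv
    have hv' : ∀ i, hM.eigenvalues i ≤ lam → e (φ v) i = 0 := fun i hi => congrFun hv ⟨i, hi⟩
    have hnn : ∀ i ∈ Finset.univ, 0 ≤ (hM.eigenvalues i - lam) * ‖e (φ v) i‖ ^ 2 := fun i _ => by
      by_cases hi : hM.eigenvalues i ≤ lam
      · simp [hv' i hi]
      · exact mul_nonneg (by linarith) (by positivity)
    have hz := (Finset.sum_eq_zero_iff_of_nonneg hnn).1
      (le_antisymm ((he _).symm.trans_le (h v)) (Finset.sum_nonneg hnn))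
    have : e (φ v) = 0 := by
      funext i
      by_cases hi : hM.eigenvalues i ≤ lam
      · exact hv' i hi
      · have := hz i (Finset.mem_univ i)
        rcases mul_eq_zero.1 this with h0 | h0
        · linarith
        · simpa using h0
    exact hφ (by simpa using this)
  have := LinearMap.finrank_le_finrank_of_injective hinj
  rwa [Module.finrank_fintype_fun_eq_card] at this

/-- The span of the eigenvectors for eigenvalues at most `lam` attains the bound of
`finrank_le_eigenvalueCount`; together they give the variational description of the count. -/
theorem exists_form_nonpos [Fintype ι] {M : Matrix ι ι ℂ} (hM : M.IsHermitian) (lam : ℝ) :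
    ∃ φ : (Fin (eigenvalueCount M lam) → ℂ) →ₗ[ℂ] (ι → ℂ), Function.Injective φ ∧
      ∀ v, shiftedForm M lam (φ v) ≤ 0 := by
  classical
  obtain ⟨e, he⟩ := exists_coordinates hM lam
  have hcard : Fintype.card {i // hM.eigenvalues i ≤ lam} =
      Fintype.card (Fin (eigenvalueCount M lam)) := by
    rw [eigenvalueCount_eq_card hM, Fintype.card_fin]
  let f := Fintype.equivOfCardEq hcard
  let g : Fin (eigenvalueCount M lam) → ι := fun i => (f.symm i).1
  have hg : Function.Injective g := Subtype.val_injective.comp f.symm.injective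
  refine ⟨e.symm.toLinearMap ∘ₗ Function.ExtendByZero.linearMap ℂ g,
    e.symm.injective.comp (extend_zero_injective hg), fun v => ?_⟩
  rw [he]
  refine Finset.sum_nonpos fun i _ => ?_
  simp only [LinearMap.coe_comp, LinearEquiv.coe_coe, Function.comp_apply,
    LinearEquiv.apply_symm_apply, Function.ExtendByZero.linearMap_apply]
  by_cases hi : hM.eigenvalues i ≤ lam
  · exact mul_nonpos_of_nonpos_of_nonneg (by linarith) (by positivity)
  · rw [Function.extend_apply']
    · simp
    · rintro ⟨k, rfl⟩
      exact hi (f.symm k).2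

theorem shiftedForm_submatrix [Fintype ι] [Fintype κ] (M : Matrix ι ι ℂ) (lam : ℝ) {g : κ → ι}
    (hg : Function.Injective g) (v : ι → ℂ) (hv : ∀ i ∉ Set.range g, v i = 0) :
    shiftedForm (M.submatrix g g) lam (v ∘ g) = shiftedForm M lam v := by
  classical
  have hsum : ∀ w : ι → ℂ, (∀ i ∉ Set.range g, w i = 0) → ∑ k, w (g k) = ∑ i, w i := by
    intro w hw
    rw [← Finset.sum_image (s := Finset.univ) (g := g) (f := w) fun a _ b _ h => hg h]
    refine Finset.sum_subset (Finset.subset_univ _) fun i _ hi => hw i ?_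
    simpa using hi
  have h₁ : star (v ∘ g) ⬝ᵥ (v ∘ g) = star v ⬝ᵥ v :=
    hsum (fun i => star (v i) * v i) fun i hi => by simp [hv i hi]
  have h₂ : (M.submatrix g g) *ᵥ (v ∘ g) = (M *ᵥ v) ∘ g := by
    funext k
    exact hsum (fun i => M (g k) i * v i) fun i hi => by simp [hv i hi]
  have h₃ : star (v ∘ g) ⬝ᵥ ((M *ᵥ v) ∘ g) = star v ⬝ᵥ (M *ᵥ v) :=
    hsum (fun i => star (v i) * (M *ᵥ v) i) fun i hi => by simp [hv i hi]
  rw [shiftedForm, shiftedForm, h₂, h₁, h₃]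

/-- Extension by zero preserves the form, so a space on which it is nonpositive for the submatrix
serves for the whole matrix. -/
theorem eigenvalueCount_submatrix_le [Fintype ι] [Fintype κ] {M : Matrix ι ι ℂ}
    (hM : M.IsHermitian) (lam : ℝ) {g : κ → ι} (hg : Function.Injective g) :
    eigenvalueCount (M.submatrix g g) lam ≤ eigenvalueCount M lam := by
  obtain ⟨φ, hφ, h⟩ := exists_form_nonpos (hM.submatrix g) lam
  have := finrank_le_eigenvalueCount hM (lam := lam)
    (Function.ExtendByZero.linearMap ℂ g ∘ₗ φ) ((extend_zero_injective hg).comp hφ) fun v => by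
      rw [← shiftedForm_submatrix M lam hg]
      · convert h v using 2
        funext k
        simp [Function.ExtendByZero.linearMap_apply, hg.extend_apply]
      · intro i hi
        exact Function.extend_apply' _ _ _ fun ⟨k, hk⟩ => hi ⟨k, hk⟩
  simpa using this

/-- The other half of interlacing: requiring the vectors to vanish at the deleted indices lowers the
dimension by at most the number of these indices (rank-nullity), and the remaining vectors live on
the submatrix. -/
theorem eigenvalueCount_le_submatrix_add [Fintype ι] [Fintype κ] {M : Matrix ι ι ℂ}
    (hM : M.IsHermitian) (lam : ℝ) {g : κ → ι} (hg : Function.Injective g) :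
    eigenvalueCount M lam ≤
      eigenvalueCount (M.submatrix g g) lam + (Set.range g)ᶜ.ncard := by
  classical
  obtain ⟨φ, hφ, h⟩ := exists_form_nonpos hM lam
  let q : (Fin (eigenvalueCount M lam) → ℂ) →ₗ[ℂ] (((Set.range g)ᶜ : Set ι) → ℂ) :=
    LinearMap.funLeft ℂ ℂ Subtype.val ∘ₗ φ
  have hq : ∀ v : LinearMap.ker q, ∀ i ∉ Set.range g, φ v i = 0 := fun v i hi =>
    congrFun (LinearMap.mem_ker.1 v.2) ⟨i, hi⟩
  have h₁ : Module.finrank ℂ (LinearMap.range q) ≤ (Set.range g)ᶜ.ncard := by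
    refine (Submodule.finrank_le _).trans ?_
    rw [Module.finrank_fintype_fun_eq_card, ← Nat.card_eq_fintype_card]
    rfl
  have h₂ := finrank_le_eigenvalueCount (hM.submatrix g) (lam := lam)
    (LinearMap.funLeft ℂ ℂ g ∘ₗ φ ∘ₗ (LinearMap.ker q).subtype)
    (by
      rw [← LinearMap.ker_eq_bot, LinearMap.ker_eq_bot']
      intro v hv
      have : φ v = 0 := by
        funext i
        by_cases hi : i ∈ Set.range g
        · obtain ⟨k, rfl⟩ := hi
          exact congrFun hv k
        · exact hq v i hi
      exact Subtype.ext (hφ (by simpa using this)))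
    (fun v => (shiftedForm_submatrix M lam hg (φ v) (hq v)).trans_le (h v))
  have h₃ := LinearMap.finrank_range_add_finrank_ker q
  rw [Module.finrank_fin_fun] at h₃
  omega

theorem eigenvalueCount_reindex (e : ι ≃ κ) (M : Matrix ι ι ℂ) (N : Matrix κ κ ℂ)
    (h : ∀ i j, M i j = N (e i) (e j)) (lam : ℝ) :
    eigenvalueCount M lam = eigenvalueCount N lam := by
  classical
  by_cases hι : Finite ι
  · have hκ : Finite κ := Finite.of_equiv ι e
    let : Fintype ι := Fintype.ofFinite ι
    let : Fintype κ := Fintype.ofFinite κ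
    have hN : reindex e e M = N := by
      ext i j
      simp [h]
    rw [eigenvalueCount_eq_countP, eigenvalueCount_eq_countP, ← hN, charpoly_reindex]
  · have hκ : ¬ Finite κ := fun hκ => hι (Finite.of_equiv κ e.symm)
    rw [eigenvalueCount, eigenvalueCount, dif_neg hι, dif_neg hκ]

theorem eigenvalueCount_fromBlocks [Finite ι] [Finite κ] (M : Matrix ι ι ℂ) (N : Matrix κ κ ℂ)
    (lam : ℝ) : eigenvalueCount (fromBlocks M 0 0 N) lam =
      eigenvalueCount M lam + eigenvalueCount N lam := by
  classical
  let : Fintype ι := Fintype.ofFinite ι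
  let : Fintype κ := Fintype.ofFinite κ
  rw [eigenvalueCount_eq_countP, eigenvalueCount_eq_countP, eigenvalueCount_eq_countP,
    charpoly_fromBlocks_zero₁₂,
    Polynomial.roots_mul (mul_ne_zero (charpoly_monic M).ne_zero (charpoly_monic N).ne_zero),
    Multiset.countP_add]

/-- The number of eigenvalues at most `lam` of the restriction of a kernel to a set. -/
def kernelCount (a : ι → ι → ℂ) (lam : ℝ) (X : Set ι) : ℕ :=
  eigenvalueCount (Matrix.of fun x y : X => a x y) lam

theorem isHermitian_restriction {a : ι → ι → ℂ} (ha : ∀ x y, a y x = star (a x y)) (X : Set ι) :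
    (Matrix.of fun x y : X => a x y).IsHermitian := by
  ext x y
  simp [ha x.1 y.1]

theorem kernelCount_mono {a : ι → ι → ℂ} (ha : ∀ x y, a y x = star (a x y)) (lam : ℝ)
    {X Y : Set ι} (hY : Y.Finite) (h : X ⊆ Y) : kernelCount a lam X ≤ kernelCount a lam Y := by
  have := hY.fintype
  have := (hY.subset h).fintype
  exact eigenvalueCount_submatrix_le (isHermitian_restriction ha Y) lam
    (g := fun x : X => (⟨x.1, h x.2⟩ : Y)) fun x y hxy => Subtype.ext (by simpa using hxy)

theorem kernelCount_le_add {a : ι → ι → ℂ} (ha : ∀ x y, a y x = star (a x y)) (lam : ℝ)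
    {X Y : Set ι} (hY : Y.Finite) (h : X ⊆ Y) :
    kernelCount a lam Y ≤ kernelCount a lam X + (Y \ X).ncard := by
  have := hY.fintype
  have := (hY.subset h).fintype
  refine (eigenvalueCount_le_submatrix_add (isHermitian_restriction ha Y) lam
    (g := fun x : X => (⟨x.1, h x.2⟩ : Y))
    fun x y hxy => Subtype.ext (by simpa using hxy)).trans ?_
  refine Nat.add_le_add le_rfl ?_
  rw [← Set.ncard_image_of_injective _ Subtype.val_injective]
  refine Set.ncard_le_ncard ?_ (hY.subset Set.sdiff_subset)
  rintro _ ⟨y, hy, rfl⟩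
  exact ⟨y.2, fun hx => hy ⟨⟨y.1, hx⟩, rfl⟩⟩

theorem kernelCount_empty (a : ι → ι → ℂ) (lam : ℝ) : kernelCount a lam ∅ = 0 := by
  classical
  rw [kernelCount, eigenvalueCount_eq_countP, charpoly, det_isEmpty]
  simp

theorem kernelCount_le_ncard {a : ι → ι → ℂ} (ha : ∀ x y, a y x = star (a x y)) (lam : ℝ)
    {X : Set ι} (hX : X.Finite) : kernelCount a lam X ≤ X.ncard := by
  simpa [kernelCount_empty] using kernelCount_le_add ha lam hX (Set.empty_subset X)

/-- The matrix is block diagonal, so its characteristic polynomial is the product of those of the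
blocks. -/
theorem kernelCount_union (a : ι → ι → ℂ) (lam : ℝ) {X Y : Set ι} (hX : X.Finite) (hY : Y.Finite)
    (hXY : Disjoint X Y) (h : ∀ x ∈ X, ∀ y ∈ Y, a x y = 0 ∧ a y x = 0) :
    kernelCount a lam (X ∪ Y) = kernelCount a lam X + kernelCount a lam Y := by
  classical
  have := hX.to_subtype
  have := hY.to_subtype
  rw [kernelCount, kernelCount, kernelCount, ← eigenvalueCount_fromBlocks]
  refine (eigenvalueCount_reindex (Equiv.Set.union hXY).symm _ _ (fun i j => ?_) lam).symm
  rcases i with i | i <;> rcases j with j | j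
  · simp
  · simp [(h i i.2 j j.2).1]
  · simp [(h j j.2 i i.2).2]
  · simp

end Counting

end LRTiling
end

/-! ### Counting tiles by volume, and almost additivity of the eigenvalue count. -/

noncomputable section

namespace LRTiling

open MeasureTheory

variable {d : ℕ} {Γ : Type*}

theorem abs_coord_sub_le (p q : Space d) (j : Fin d) : |p j - q j| ≤ dist p q := by
  rw [dist_eq_norm, ← Real.norm_eq_abs]
  exact PiLp.norm_apply_le (p - q) j

namespace Box

theorem toSet_eq_preimage (B : Box d) :
    B.toSet = WithLp.ofLp ⁻¹' Set.Icc B.lower B.upper := by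
  ext x
  simp [toSet, Pi.le_def, forall_and]

theorem mem_interior_toSet (B : Box d) (x : Space d) :
    x ∈ interior B.toSet ↔ ∀ j, B.lower j < x j ∧ x j < B.upper j := by
  have h : B.toSet = (EuclideanSpace.equiv (Fin d) ℝ).toHomeomorph ⁻¹'
      (Set.pi Set.univ fun j => Set.Icc (B.lower j) (B.upper j)) := by
    ext x
    simp only [toSet, Set.mem_ofPred_eq, Set.mem_preimage, Set.mem_pi, Set.mem_univ, Set.mem_Icc,
      forall_const]
    rfl
  rw [h, ← Homeomorph.preimage_interior, interior_pi_set Set.finite_univ]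
  simp

theorem volume_toSet (B : Box d) : volume B.toSet = ENNReal.ofReal B.vol := by
  have h : B.lower ≤ B.upper := fun j => (B.lower_lt_upper j).le
  rw [toSet_eq_preimage, (PiLp.volume_preserving_ofLp (Fin d)).measure_preimage
    measurableSet_Icc.nullMeasurableSet, Real.volume_Icc_pi, vol,
    ENNReal.ofReal_prod_of_nonneg fun j _ => sub_nonneg.2 (h j)]

/-- The box with all faces moved outwards by `E`. -/
def grow (B : Box d) (E : ℝ) (hE : 0 ≤ E) : Box d where
  lower j := B.lower j - E
  upper j := B.upper j + E
  lower_lt_upper j := by linarith [B.lower_lt_upper j]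

theorem side_grow (B : Box d) {E : ℝ} (hE : 0 ≤ E) (j : Fin d) :
    (B.grow E hE).side j = B.side j + 2 * E := by
  simp only [side, grow]
  ring

theorem mem_grow_of_dist_le (B : Box d) {E : ℝ} (hE : 0 ≤ E) {p q : Space d} (hp : p ∈ B.toSet)
    (h : dist q p ≤ E) : q ∈ (B.grow E hE).toSet := fun j => by
  have h₁ := hp j
  have h₂ := abs_le.1 ((abs_coord_sub_le q p j).trans h)
  simp only [grow]
  constructor <;> linarith

theorem subset_grow (B : Box d) {E : ℝ} (hE : 0 ≤ E) : B.toSet ⊆ (B.grow E hE).toSet :=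
  fun p hp => B.mem_grow_of_dist_le hE hp (by simpa using hE)

/-- Sides of length at least one grow by a factor of at most `1 + 2 * E`. The set `s` of directions
is left free so that both the volume and the faces are covered. -/
theorem prod_side_grow_le (B : Box d) {E : ℝ} (hE : 0 ≤ E) (hB : ∀ j, 1 ≤ B.side j)
    (s : Finset (Fin d)) :
    ∏ i ∈ s, (B.grow E hE).side i ≤ (1 + 2 * E) ^ d * ∏ i ∈ s, B.side i := by
  calc ∏ i ∈ s, (B.grow E hE).side i ≤ ∏ i ∈ s, (1 + 2 * E) * B.side i := by
        refine Finset.prod_le_prod (fun i _ => ((B.grow E hE).side_pos i).le) fun i _ => ?_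
        rw [side_grow]
        nlinarith [hB i]
    _ = (1 + 2 * E) ^ s.card * ∏ i ∈ s, B.side i := by
        rw [Finset.prod_mul_distrib, Finset.prod_const]
    _ ≤ _ := by
        refine mul_le_mul_of_nonneg_right ?_ (Finset.prod_nonneg fun i _ => (B.side_pos i).le)
        refine pow_le_pow_right₀ (by linarith) ?_
        simpa using Finset.card_le_univ s

/-- The translate of a box. -/
def translate (B : Box d) (t : Space d) : Box d where
  lower j := B.lower j + t j
  upper j := B.upper j + t j
  lower_lt_upper j := by linarith [B.lower_lt_upper j]

theorem side_translate (B : Box d) (t : Space d) (j : Fin d) : (B.translate t).side j = B.side j := by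
  simp [side, translate]

theorem mem_translate (B : Box d) (t p : Space d) : p ∈ (B.translate t).toSet ↔ p - t ∈ B.toSet := by
  simp [toSet, translate, le_sub_iff_add_le]

theorem mem_interior_translate (B : Box d) (t p : Space d) :
    p ∈ interior (B.translate t).toSet ↔ p - t ∈ interior B.toSet := by
  simp [mem_interior_toSet, translate, lt_sub_iff_add_lt, sub_lt_iff_lt_add]

/-- The midpoint of a box. -/
def center (B : Box d) : Space d := WithLp.toLp 2 fun j => (B.lower j + B.upper j) / 2

theorem subset_closedBall (B : Box d) {r : ℝ} (hr : 0 ≤ r) (h : ∀ j, B.side j ≤ 2 * r) :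
    B.toSet ⊆ Metric.closedBall B.center (d * r) := by
  intro p hp
  rw [Metric.mem_closedBall, dist_eq_norm, EuclideanSpace.norm_eq]
  refine Real.sqrt_le_iff.2 ⟨by positivity, ?_⟩
  have : ∀ j ∈ Finset.univ, ‖(p - B.center) j‖ ^ 2 ≤ r ^ 2 := fun j _ => by
    have h₁ := hp j
    have h₂ := h j
    rw [side] at h₂
    rw [Real.norm_eq_abs, sq_abs]
    refine sq_le_sq' ?_ ?_ <;> simp only [PiLp.sub_apply, center] <;> linarith
  refine (Finset.sum_le_sum this).trans ?_
  simp only [Finset.sum_const, Finset.card_univ, Fintype.card_fin, nsmul_eq_mul]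
  rw [mul_pow]
  refine mul_le_mul_of_nonneg_right ?_ (sq_nonneg r)
  exact_mod_cast Nat.le_self_pow two_ne_zero d

end Box

/-- A tiling by tiles that contain a ball of radius `ρ` and have diameter at most `D`. -/
structure UniformTiling (ρ D : ℝ) (S : Set (Tile d Γ)) : Prop where
  isTiling : IsTiling S
  exists_ball : ∀ m ∈ S, ∃ p, Metric.closedBall p ρ ⊆ m.1
  dist_le : ∀ m ∈ S, ∀ p ∈ m.1, ∀ q ∈ m.1, dist p q ≤ D

theorem isCompact_of_homeomorph {K : Set (Space d)}
    (h : Nonempty (K ≃ₜ Metric.closedBall (0 : Space d) 1)) : IsCompact K := by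
  obtain ⟨e⟩ := h
  have : CompactSpace (Metric.closedBall (0 : Space d) 1) :=
    isCompact_iff_compactSpace.1 (isCompact_closedBall _ _)
  exact isCompact_iff_compactSpace.2 e.symm.compactSpace

theorem nonempty_of_homeomorph {K : Set (Space d)}
    (h : Nonempty (K ≃ₜ Metric.closedBall (0 : Space d) 1)) : K.Nonempty := by
  obtain ⟨e⟩ := h
  exact ⟨_, (e.symm ⟨0, by simp⟩).2⟩

theorem IsTileFamily.mono {M N : Set (Tile d Γ)} (hN : IsTileFamily N) (h : M ⊆ N) :
    IsTileFamily M :=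
  ⟨fun m hm => hN.1 m (h hm), hN.2.mono h⟩

/-- The radii in the definition of admissibility give uniform bounds for the tiles. -/
theorem IsAdmissible.exists_uniform {Ps : Set (AbstractPattern d Γ)} (h : IsAdmissible Ps) :
    ∃ ρ D : ℝ, 0 < ρ ∧ 0 < D ∧ ∀ S ∈ tilingSpace Ps, UniformTiling ρ D S := by
  obtain ⟨rmin, rmax, hmin, hmax, hr⟩ := h.radii
  -- The slack in `rmin / 2` and `rmax + 1` yields actual balls without showing that the supremum
  -- and the infimum are attained.
  refine ⟨rmin / 2, 2 * (rmax + 1), by linarith, by linarith, fun S hS => ?_⟩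
  have hrad : ∀ m ∈ S, rmin ≤ innerRadius m.1 ∧ outerRadius m.1 ≤ rmax := fun m hm => by
    have hsub : {m} ⊆ S := Set.singleton_subset_iff.2 hm
    have := hr ⟨{m}, Set.finite_singleton m, hS.1.1.mono hsub⟩ (hS.2 ⟨_, hsub, rfl⟩) m rfl
    exact ⟨this.1, this.2.2⟩
  refine ⟨hS.1, fun m hm => ?_, fun m hm p hp q hq => ?_⟩
  · have hlt : rmin / 2 < innerRadius m.1 := by linarith [(hrad m hm).1]
    rw [innerRadius] at hlt
    -- A ball of negative radius is empty.
    have hne : {r | ∃ x, Metric.closedBall x r ⊆ m.1}.Nonempty :=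
      ⟨-1, 0, by simp⟩
    obtain ⟨r, ⟨x, hx⟩, hr⟩ := exists_lt_of_lt_csSup hne hlt
    exact ⟨x, (Metric.closedBall_subset_closedBall hr.le).trans hx⟩
  · have hlt : outerRadius m.1 < rmax + 1 := by linarith [(hrad m hm).2]
    rw [outerRadius] at hlt
    obtain ⟨r₀, hr₀⟩ := (isCompact_of_homeomorph (hS.1.1.1 m hm)).isBounded.subset_closedBall 0
    have hne : {r | ∃ x, m.1 ⊆ Metric.closedBall x r}.Nonempty := ⟨r₀, 0, hr₀⟩
    obtain ⟨r, ⟨x, hx⟩, hr⟩ := exists_lt_of_csInf_lt hne hlt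
    have h₁ := Metric.mem_closedBall.1 (hx hp)
    have h₂ := Metric.mem_closedBall'.1 (hx hq)
    linarith [dist_triangle p x q]

section Count

variable {ρ D : ℝ} {S : Set (Tile d Γ)}

/-- The volume of a ball of radius `ρ`. -/
def ballVol (d : ℕ) (ρ : ℝ) : ℝ := (volume (Metric.ball (0 : Space d) ρ)).toReal

theorem ballVol_pos (hρ : 0 < ρ) : 0 < ballVol d ρ :=
  ENNReal.toReal_pos (Metric.measure_ball_pos _ _ hρ).ne' measure_ball_lt_top.ne

/-- The open balls of radius `ρ` inside the tiles are pairwise disjoint because the interiors of the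
tiles are. -/
theorem UniformTiling.card_mul_le (hS : UniformTiling ρ D S) {Q : Box d} (F : Finset S)
    (h : ∀ x ∈ F, x.1.1 ⊆ Q.toSet) : F.card * ballVol d ρ ≤ Q.vol := by
  choose c hc using fun x : S => hS.exists_ball x.1 x.2
  have hsub : ∀ x : S, Metric.ball (c x) ρ ⊆ interior x.1.1 := fun x =>
    interior_maximal (Metric.ball_subset_closedBall.trans (hc x)) Metric.isOpen_ball
  have h₁ : volume (⋃ x ∈ F, Metric.ball (c x) ρ) ≤ volume Q.toSet :=
    measure_mono (Set.iUnion₂_subset fun x hx => (hsub x).trans (interior_subset.trans (h x hx)))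
  rw [measure_biUnion_finset (fun x _ y _ hxy =>
    (hS.isTiling.1.2 x.2 y.2 fun e => hxy (Subtype.ext e)).mono (hsub x) (hsub y))
    fun x _ => Metric.isOpen_ball.measurableSet] at h₁
  simp only [Measure.addHaar_ball_center, Finset.sum_const, nsmul_eq_mul, Box.volume_toSet] at h₁
  have h₂ := ENNReal.toReal_mono ENNReal.ofReal_ne_top h₁
  rw [ENNReal.toReal_mul, ENNReal.toReal_ofReal Q.vol_pos.le, ENNReal.toReal_natCast] at h₂
  exact h₂

theorem UniformTiling.finite_of_subset (hS : UniformTiling ρ D S) (hρ : 0 < ρ) {Q : Box d}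
    {X : Set S} (h : ∀ x ∈ X, x.1.1 ⊆ Q.toSet) : X.Finite := by
  by_contra hX
  obtain ⟨n, hn⟩ := exists_nat_gt (Q.vol / ballVol d ρ)
  obtain ⟨F, hF, hcard⟩ := Set.Infinite.exists_subset_card_eq hX n
  have := hS.card_mul_le F fun x hx => h x (hF hx)
  rw [div_lt_iff₀ (ballVol_pos hρ)] at hn
  rw [hcard] at this
  linarith

theorem UniformTiling.ncard_le (hS : UniformTiling ρ D S) (hρ : 0 < ρ) {Q : Box d}
    {X : Set S} (h : ∀ x ∈ X, x.1.1 ⊆ Q.toSet) : (X.ncard : ℝ) ≤ Q.vol / ballVol d ρ := by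
  have hX := hS.finite_of_subset hρ h
  rw [le_div_iff₀ (ballVol_pos hρ), Set.ncard_eq_toFinset_card X hX]
  exact hS.card_mul_le _ fun x hx => h x (by simpa using hx)

theorem UniformTiling.subset_grow (hS : UniformTiling ρ D S) (hD : 0 ≤ D) {m : Tile d Γ}
    (hm : m ∈ S) {B : Box d} (h : (m.1 ∩ B.toSet).Nonempty) : m.1 ⊆ (B.grow D hD).toSet := by
  obtain ⟨p, hp, hpB⟩ := h
  exact fun q hq => B.mem_grow_of_dist_le hD hpB (hS.dist_le m hm q hq p hp)

theorem UniformTiling.finite_meeting (hS : UniformTiling ρ D S) (hρ : 0 < ρ) (hD : 0 ≤ D)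
    (B : Box d) : {m ∈ S | (m.1 ∩ B.toSet).Nonempty}.Finite := by
  have := hS.finite_of_subset hρ (Q := B.grow D hD) (X := {x : S | (x.1.1 ∩ B.toSet).Nonempty})
    fun x hx => hS.subset_grow hD x.2 hx
  refine (this.image Subtype.val).subset ?_
  rintro m ⟨hm, hB⟩
  exact ⟨⟨m, hm⟩, hB, rfl⟩

/-- The tiles that meet the interior of a box. -/
def boxTiles (S : Set (Tile d Γ)) (B : Box d) : Set S :=
  {x | (x.1.1 ∩ interior B.toSet).Nonempty}

theorem UniformTiling.subset_of_mem_boxTiles (hS : UniformTiling ρ D S) (hD : 0 ≤ D) {B : Box d}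
    {x : S} (hx : x ∈ boxTiles S B) : x.1.1 ⊆ (B.grow D hD).toSet :=
  hS.subset_grow hD x.2 (hx.mono (Set.inter_subset_inter_right _ interior_subset))

variable {a : S → S → ℂ}

theorem UniformTiling.kernelCount_boxTiles_le (hS : UniformTiling ρ D S) (hρ : 0 < ρ) (hD : 0 ≤ D)
    (ha : ∀ x y, a y x = star (a x y)) (lam : ℝ) {B : Box d} (hB : ∀ j, 1 ≤ B.side j) :
    (kernelCount a lam (boxTiles S B) : ℝ) ≤ (1 + 2 * D) ^ d / ballVol d ρ * B.vol := by
  have hsub := fun x (hx : x ∈ boxTiles S B) => hS.subset_of_mem_boxTiles hD hx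
  have h₁ : (kernelCount a lam (boxTiles S B) : ℝ) ≤ (boxTiles S B).ncard := by
    exact_mod_cast kernelCount_le_ncard ha lam (hS.finite_of_subset hρ hsub)
  refine (h₁.trans (hS.ncard_le hρ hsub)).trans ?_
  rw [div_mul_eq_mul_div]
  exact div_le_div_of_nonneg_right (B.prod_side_grow_le hD hB Finset.univ) (ballVol_pos hρ).le

/-- The eigenvalue counting function is additive up to a surface term. -/
theorem UniformTiling.abs_kernelCount_cut_le (hS : UniformTiling ρ D S) (hρ : 0 < ρ) (hD : 0 < D)
    (ha : ∀ x y, a y x = star (a x y)) {R : ℝ} (hR : 0 ≤ R)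
    (hfr : ∀ x y : S, R ≤ tileDist x.1 y.1 → a x y = 0) (lam : ℝ) (B : Box d) (j : Fin d) (c : ℝ)
    (h₁ : B.lower j < c) (h₂ : c < B.upper j) (hB : ∀ i, 1 ≤ B.side i) :
    |(kernelCount a lam (boxTiles S B) : ℝ) -
      (kernelCount a lam (boxTiles S (B.withFactor j _ _ h₁)) +
        kernelCount a lam (boxTiles S (B.withFactor j _ _ h₂)))| ≤
      3 * (2 * (R + D) * (1 + 2 * D) ^ d / ballVol d ρ) * B.face j := by
  set I := boxTiles S B
  set I₁ := boxTiles S (B.withFactor j _ _ h₁) with hI₁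
  set I₂ := boxTiles S (B.withFactor j _ _ h₂) with hI₂
  -- Tiles strictly on one side of the cut, farther than `R` from it; `W` collects the tiles near
  -- the hyperplane, including those that meet both halves.
  let J₁ : Set S := {x ∈ I | ∀ p ∈ x.1.1, p j < c - R}
  let J₂ : Set S := {x ∈ I | ∀ p ∈ x.1.1, c + R < p j}
  let W : Set S := I \ (J₁ ∪ J₂)
  have hne : ∀ x : S, x.1.1.Nonempty := fun x => nonempty_of_homeomorph (hS.isTiling.1.1 x.1 x.2)
  have mem₁ : ∀ p : Space d, p ∈ interior (B.withFactor j _ _ h₁).toSet ↔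
      p ∈ interior B.toSet ∧ p j < c := by
    intro p
    simp only [Box.mem_interior_toSet, Box.withFactor]
    refine ⟨fun h => ⟨fun i => ?_, by simpa using (h j).2⟩, fun h i => ?_⟩
    · rcases eq_or_ne i j with rfl | hi
      · have := h i
        simp only [Function.update_self] at this
        exact ⟨this.1, this.2.trans h₂⟩
      · simpa [hi] using h i
    · rcases eq_or_ne i j with rfl | hi
      · simpa using ⟨(h.1 i).1, h.2⟩
      · simpa [hi] using h.1 i
  have mem₂ : ∀ p : Space d, p ∈ interior (B.withFactor j _ _ h₂).toSet ↔
      p ∈ interior B.toSet ∧ c < p j := by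
    intro p
    simp only [Box.mem_interior_toSet, Box.withFactor]
    refine ⟨fun h => ⟨fun i => ?_, by simpa using (h j).1⟩, fun h i => ?_⟩
    · rcases eq_or_ne i j with rfl | hi
      · have := h i
        simp only [Function.update_self] at this
        exact ⟨h₁.trans this.1, this.2⟩
      · simpa [hi] using h i
    · rcases eq_or_ne i j with rfl | hi
      · simpa using ⟨h.2, (h.1 i).2⟩
      · simpa [hi] using h.1 i
  have hI : I.Finite := hS.finite_of_subset hρ fun x hx => hS.subset_of_mem_boxTiles hD.le hx
  have hI₁I : I₁ ⊆ I := fun x ⟨p, hp, hpB⟩ => ⟨p, hp, ((mem₁ p).1 hpB).1⟩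
  have hI₂I : I₂ ⊆ I := fun x ⟨p, hp, hpB⟩ => ⟨p, hp, ((mem₂ p).1 hpB).1⟩
  have hJ₁ : J₁ ⊆ I₁ := fun x hx => by
    obtain ⟨p, hp, hpB⟩ := hx.1
    exact ⟨p, hp, (mem₁ p).2 ⟨hpB, by linarith [hx.2 p hp]⟩⟩
  have hJ₂ : J₂ ⊆ I₂ := fun x hx => by
    obtain ⟨p, hp, hpB⟩ := hx.1
    exact ⟨p, hp, (mem₂ p).2 ⟨hpB, by linarith [hx.2 p hp]⟩⟩
  have hW₁ : I₁ \ J₁ ⊆ W := fun x hx => by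
    refine ⟨hI₁I hx.1, fun h => h.elim hx.2 fun h => ?_⟩
    obtain ⟨p, hp, hpB⟩ := hx.1
    linarith [h.2 p hp, ((mem₁ p).1 hpB).2]
  have hW₂ : I₂ \ J₂ ⊆ W := fun x hx => by
    refine ⟨hI₂I hx.1, fun h => h.elim (fun h => ?_) hx.2⟩
    obtain ⟨p, hp, hpB⟩ := hx.1
    linarith [h.2 p hp, ((mem₂ p).1 hpB).2]
  have hWfin : W.Finite := hI.subset Set.sdiff_subset
  have hdisj : Disjoint J₁ J₂ := Set.disjoint_left.2 fun x hx hx' => by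
    obtain ⟨p, hp⟩ := hne x
    linarith [hx.2 p hp, hx'.2 p hp]
  have hzero : ∀ x ∈ J₁, ∀ y ∈ J₂, a x y = 0 ∧ a y x = 0 := by
    intro x hx y hy
    have h0 : a x y = 0 := by
      refine hfr x y (le_csInf ((hne x).image2 (hne y)) ?_)
      rintro _ ⟨p, hp, q, hq, rfl⟩
      have := abs_le.1 (abs_coord_sub_le p q j)
      linarith [hx.2 p hp, hy.2 q hq]
    exact ⟨h0, by rw [ha, h0, star_zero]⟩
  have hsum := kernelCount_union a lam (hI.subset (hJ₁.trans hI₁I)) (hI.subset (hJ₂.trans hI₂I))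
    hdisj hzero
  have hJI : J₁ ∪ J₂ ⊆ I := Set.union_subset (hJ₁.trans hI₁I) (hJ₂.trans hI₂I)
  have e₁ := kernelCount_mono ha lam hI hJI
  have e₂ := kernelCount_le_add ha lam hI hJI
  have e₃ := kernelCount_mono ha lam (hI.subset hI₁I) hJ₁
  have e₄ := kernelCount_le_add ha lam (hI.subset hI₁I) hJ₁
  have e₅ := kernelCount_mono ha lam (hI.subset hI₂I) hJ₂
  have e₆ := kernelCount_le_add ha lam (hI.subset hI₂I) hJ₂
  have c₁ := Set.ncard_le_ncard hW₁ hWfin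
  have c₂ := Set.ncard_le_ncard hW₂ hWfin
  -- Replacing `I`, `I₁`, `I₂` by `J₁ ∪ J₂`, `J₁`, `J₂` costs at most the size of `W` each time, and
  -- the count is additive on `J₁ ∪ J₂`.
  have hcount : |(kernelCount a lam I : ℝ) - (kernelCount a lam I₁ + kernelCount a lam I₂)| ≤
      3 * W.ncard := by
    have u₁ : kernelCount a lam I ≤ kernelCount a lam I₁ + kernelCount a lam I₂ + 3 * W.ncard := by
      change kernelCount a lam I ≤ kernelCount a lam (J₁ ∪ J₂) + W.ncard at e₂
      omega
    have u₂ : kernelCount a lam I₁ + kernelCount a lam I₂ ≤ kernelCount a lam I + 3 * W.ncard := by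
      omega
    have u₁' : (kernelCount a lam I : ℝ) ≤
      kernelCount a lam I₁ + kernelCount a lam I₂ + 3 * W.ncard := by exact_mod_cast u₁
    have u₂' : (kernelCount a lam I₁ : ℝ) + kernelCount a lam I₂ ≤
      kernelCount a lam I + 3 * W.ncard := by exact_mod_cast u₂
    rw [abs_le]
    constructor <;> linarith
  refine hcount.trans ?_
  -- A tile of `W` has points on both sides of the thresholds `c - R` and `c + R`, so it lies within
  -- `R + D` of the hyperplane. Positivity of `D` keeps the slab nondegenerate when `R = 0`.
  have hslab : c - (R + D) < c + (R + D) := by linarith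
  have hWsub : ∀ x ∈ W, x.1.1 ⊆ ((B.grow D hD.le).withFactor j _ _ hslab).toSet := by
    intro x hx z hz i
    have hgrow := hS.subset_of_mem_boxTiles hD.le hx.1 hz
    simp only [Box.withFactor]
    rcases eq_or_ne i j with rfl | hi
    · obtain ⟨p, hp, hpj⟩ : ∃ p ∈ x.1.1, c - R ≤ p i := by
        by_contra! h
        exact hx.2 (Or.inl ⟨hx.1, h⟩)
      obtain ⟨q, hq, hqj⟩ : ∃ q ∈ x.1.1, q i ≤ c + R := by
        by_contra! h
        exact hx.2 (Or.inr ⟨hx.1, h⟩)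
      have d₁ := abs_le.1 ((abs_coord_sub_le z p i).trans (hS.dist_le x.1 x.2 z hz p hp))
      have d₂ := abs_le.1 ((abs_coord_sub_le z q i).trans (hS.dist_le x.1 x.2 z hz q hq))
      simp only [Function.update_self]
      constructor <;> linarith
    · simpa [hi] using hgrow i
  have hWle := hS.ncard_le hρ hWsub
  rw [Box.vol_withFactor] at hWle
  have hface : (B.grow D hD.le).face j ≤ (1 + 2 * D) ^ d * B.face j :=
    B.prod_side_grow_le hD.le hB _
  have hv := ballVol_pos (d := d) hρ
  calc 3 * (W.ncard : ℝ)
      ≤ 3 * ((c + (R + D) - (c - (R + D))) * (B.grow D hD.le).face j / ballVol d ρ) := by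
        linarith
    _ ≤ 3 * ((c + (R + D) - (c - (R + D))) * ((1 + 2 * D) ^ d * B.face j) / ballVol d ρ) := by
        have : 0 ≤ c + (R + D) - (c - (R + D)) := by linarith
        gcongr
    _ = _ := by ring

end Count

end LRTiling
end

/-! ### Translations of patches and the operators on other tilings. -/

noncomputable section

namespace LRTiling

open MeasureTheory

variable {d : ℕ} {Γ : Type*}

theorem Tile.mem_shift (t p : Space d) (m : Tile d Γ) : p ∈ (m.shift t).1 ↔ p - t ∈ m.1 := by
  constructor
  · rintro ⟨q, hq, rfl⟩
    simpa using hq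
  · exact fun h => ⟨_, h, sub_add_cancel p t⟩

theorem Tile.shift_shift (t u : Space d) (m : Tile d Γ) : (m.shift t).shift u = m.shift (t + u) := by
  simp only [Tile.shift, Set.image_image, add_assoc]

theorem Tile.shift_zero (m : Tile d Γ) : m.shift 0 = m := by
  simp [Tile.shift]

theorem Tile.shift_injective (t : Space d) : Function.Injective (Tile.shift t : Tile d Γ → _) :=
  fun m n h => by
    have := congrArg (Tile.shift (-t)) h
    simpa [Tile.shift_shift, Tile.shift_zero] using this

theorem tileDist_shift (t : Space d) (m n : Tile d Γ) :
    tileDist (m.shift t) (n.shift t) = tileDist m n := by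
  simp only [tileDist, Tile.shift, Set.image2_image_left, Set.image2_image_right, dist_add_right]

theorem SamePatch.symm {R : ℝ} {S S' : Set (Tile d Γ)} {x y x' y' : Tile d Γ}
    (h : SamePatch R S S' x y x' y') : SamePatch R S' S x' y' x y := by
  obtain ⟨t, rfl, rfl, h⟩ := h
  refine ⟨-t, ?_, ?_, ?_⟩
  · simp [Tile.shift_shift, Tile.shift_zero]
  · simp [Tile.shift_shift, Tile.shift_zero]
  · rw [← h, shiftSet_shiftSet, add_neg_cancel, shiftSet_zero]

theorem SamePatch.trans {R : ℝ} {S S' S'' : Set (Tile d Γ)} {x y x' y' x'' y'' : Tile d Γ}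
    (h : SamePatch R S S' x y x' y') (h' : SamePatch R S' S'' x' y' x'' y'') :
    SamePatch R S S'' x y x'' y'' := by
  obtain ⟨t, rfl, rfl, h⟩ := h
  obtain ⟨u, rfl, rfl, h'⟩ := h'
  refine ⟨t + u, ?_, ?_, ?_⟩
  · rw [Tile.shift_shift]
  · rw [Tile.shift_shift]
  · rw [← h', ← h, shiftSet_shiftSet]

theorem patch_comm (R : ℝ) (S : Set (Tile d Γ)) (x y : Tile d Γ) :
    patch R S x y = patch R S y x := by
  simp only [patch, or_comm]

theorem SamePatch.swap {R : ℝ} {S S' : Set (Tile d Γ)} {x y x' y' : Tile d Γ}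
    (h : SamePatch R S S' x y x' y') : SamePatch R S S' y x y' x' := by
  obtain ⟨t, rfl, rfl, h⟩ := h
  exact ⟨t, rfl, rfl, by rw [patch_comm, h, patch_comm]⟩

section Manifestation

variable {T : Set (Tile d Γ)} {A : L2 T →L[ℂ] L2 T} {R : ℝ}

theorem manifestation_eq (hI : PatternInvariant A R) {S : Set (Tile d Γ)} {x y : S} {x' y' : T}
    (h : SamePatch R S T x.1 y.1 x'.1 y'.1) :
    manifestation A R S x y = matrixElement A x' y' := by
  have hex : ∃ p : T × T, SamePatch R S T x.1 y.1 p.1.1 p.2.1 := ⟨(x', y'), h⟩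
  rw [manifestation, dif_pos hex]
  exact hI _ _ _ _ (hex.choose_spec.symm.trans h)

/-- Either both patches occur in `T`, with the same matrix element, or neither does and both values
are the default `0`. Hence no proof is needed that the patches of `S` occur in `T`. -/
theorem manifestation_congr (hI : PatternInvariant A R) {S S' : Set (Tile d Γ)} {x y : S}
    {x' y' : S'} (h : SamePatch R S S' x.1 y.1 x'.1 y'.1) :
    manifestation A R S x y = manifestation A R S' x' y' := by
  by_cases hex : ∃ p : T × T, SamePatch R S T x.1 y.1 p.1.1 p.2.1
  · obtain ⟨p, hp⟩ := hex
    rw [manifestation_eq hI hp, manifestation_eq hI (h.symm.trans hp)]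
  · have hex' : ¬ ∃ p : T × T, SamePatch R S' T x'.1 y'.1 p.1.1 p.2.1 :=
      fun ⟨p, hp⟩ => hex ⟨p, h.trans hp⟩
    rw [manifestation, manifestation, dif_neg hex, dif_neg hex']

theorem matrixElement_star (hA : IsSelfAdjoint A) (x y : T) :
    matrixElement A y x = star (matrixElement A x y) := by
  rw [matrixElement, matrixElement, Complex.star_def, inner_conj_symm,
    ← ContinuousLinearMap.adjoint_inner_left, hA.adjoint_eq]

theorem manifestation_star (hA : IsSelfAdjoint A) (hI : PatternInvariant A R)
    {S : Set (Tile d Γ)} (x y : S) : manifestation A R S y x = star (manifestation A R S x y) := by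
  by_cases hex : ∃ p : T × T, SamePatch R S T x.1 y.1 p.1.1 p.2.1
  · obtain ⟨p, hp⟩ := hex
    rw [manifestation_eq hI hp, manifestation_eq hI hp.swap, matrixElement_star hA]
  · have hex' : ¬ ∃ p : T × T, SamePatch R S T y.1 x.1 p.1.1 p.2.1 :=
      fun ⟨p, hp⟩ => hex ⟨p.swap, hp.swap⟩
    rw [manifestation, manifestation, dif_neg hex, dif_neg hex', star_zero]

theorem manifestation_eq_zero (hFR : FiniteRange A R) (hI : PatternInvariant A R)
    {S : Set (Tile d Γ)} (x y : S) (h : R ≤ tileDist x.1 y.1) : manifestation A R S x y = 0 := by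
  by_cases hex : ∃ p : T × T, SamePatch R S T x.1 y.1 p.1.1 p.2.1
  · obtain ⟨p, hp⟩ := hex
    rw [manifestation_eq hI hp]
    obtain ⟨t, h₁, h₂, -⟩ := hp
    refine hFR _ _ ?_
    rwa [← h₁, ← h₂, tileDist_shift]
  · rw [manifestation, dif_neg hex]

end Manifestation

/-- A finite form of Baire's theorem: remove the closed sets one at a time until the remaining open
set lies in the next one. It turns a covering by tiles into an overlap of interiors. -/
theorem exists_inter_interior_nonempty {X ι : Type*} [TopologicalSpace X] {f : ι → Set X}
    {F : Set ι} (hF : F.Finite) (hf : ∀ i ∈ F, IsClosed (f i)) {U : Set X} (hU : IsOpen U)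
    (hne : U.Nonempty) (hsub : U ⊆ ⋃ i ∈ F, f i) : ∃ i ∈ F, (U ∩ interior (f i)).Nonempty := by
  induction F, hF using Set.Finite.induction_on generalizing U with
  | empty =>
    obtain ⟨p, hp⟩ := hne
    simpa using hsub hp
  | @insert i F _ _ ih =>
    by_cases h : (U \ f i).Nonempty
    · obtain ⟨k, hk, hne⟩ := ih (fun k hk => hf k (Set.mem_insert_of_mem _ hk))
        (hU.sdiff (hf i (Set.mem_insert _ _))) h fun p hp => by
          have := hsub hp.1
          rw [Set.biUnion_insert] at this
          exact this.resolve_left hp.2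
      exact ⟨k, Set.mem_insert_of_mem _ hk, hne.mono (Set.inter_subset_inter_left _ Set.sdiff_subset)⟩
    · rw [Set.not_nonempty_iff_eq_empty, Set.sdiff_eq_empty] at h
      obtain ⟨p, hp⟩ := hne
      exact ⟨i, Set.mem_insert _ _, p, hp, interior_maximal h hU hp⟩

/-! ### Transport of eigenvalue counts between tilings, and copies from repetitivity. -/

section Translation

variable {ρ D : ℝ} {S S' : Set (Tile d Γ)}

theorem UniformTiling.exists_mem (hS : UniformTiling ρ D S) (p : Space d) : ∃ m ∈ S, p ∈ m.1 := by
  have : p ∈ support S := hS.isTiling.2 ▸ Set.mem_univ p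
  simpa [support] using this

/-- A tile that lies in a region where the tiling contains a translated pattern belongs to this
pattern. -/
theorem UniformTiling.exists_shift_eq (hS : UniformTiling ρ D S) (hS' : UniformTiling ρ D S')
    (hρ : 0 < ρ) (hD : 0 ≤ D) {Q : Box d} {t : Space d}
    (h : ∀ m ∈ S, (m.1 ∩ Q.toSet).Nonempty → m.shift t ∈ S') {z : Tile d Γ} (hz : z ∈ S')
    (hzQ : ∀ p ∈ z.1, p - t ∈ Q.toSet) : ∃ m ∈ S, m.shift t = z := by
  obtain ⟨q, hq⟩ := hS'.exists_ball z hz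
  have hball : Metric.ball q ρ ⊆ z.1 := Metric.ball_subset_closedBall.trans hq
  -- The ball inside `z` is covered by finitely many translated tiles of `S`. One of them overlaps
  -- it in an interior point, and as both tiles belong to `S'` they coincide.
  obtain ⟨m, ⟨hm, hmQ⟩, p, hp, hpm⟩ := exists_inter_interior_nonempty
    (f := fun m : Tile d Γ => (m.shift t).1) (hS.finite_meeting hρ hD Q)
    (fun m hm => (isCompact_of_homeomorph (hS'.isTiling.1.1 _ (h m hm.1 hm.2))).isClosed)
    Metric.isOpen_ball (Metric.nonempty_ball.2 hρ) (fun p hp => by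
      obtain ⟨m, hm, hpm⟩ := hS.exists_mem (p - t)
      exact Set.mem_iUnion₂.2 ⟨m, ⟨hm, _, hpm, hzQ p (hball hp)⟩, (Tile.mem_shift t p m).2 hpm⟩)
  refine ⟨m, hm, ?_⟩
  by_contra hne
  exact Set.disjoint_left.1 (hS'.isTiling.1.2 (h m hm hmQ) hz hne) hpm
    (interior_maximal hball Metric.isOpen_ball hp)

/-- Two tile diameters plus the distance; `R + 1` replaces `R` so that the infimum need not be
attained. -/
theorem UniformTiling.subset_grow_of_tileDist_le (hS : UniformTiling ρ D S) (hD : 0 ≤ D) {R : ℝ}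
    (hR : 0 ≤ R) {B : Box d} {x m : Tile d Γ} (hx : x ∈ S) (hm : m ∈ S)
    (hxB : (x.1 ∩ B.toSet).Nonempty) (h : tileDist m x ≤ R) :
    m.1 ⊆ (B.grow (R + 1 + 2 * D) (by linarith)).toSet := by
  have hne := (nonempty_of_homeomorph (hS.isTiling.1.1 m hm)).image2 (f := dist)
    (nonempty_of_homeomorph (hS.isTiling.1.1 x hx))
  obtain ⟨_, ⟨p, hp, q, hq, rfl⟩, hlt⟩ := exists_lt_of_csInf_lt hne
    (show sInf (Set.image2 dist m.1 x.1) < R + 1 from lt_of_le_of_lt h (by linarith))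
  obtain ⟨u, hu, huB⟩ := hxB
  intro z hz
  refine B.mem_grow_of_dist_le _ huB ?_
  have d₁ := hS.dist_le m hm z hz p hp
  have d₂ := hS.dist_le x hx q hq u hu
  linarith [dist_triangle z p u, dist_triangle p q u]

theorem inter_translate_nonempty {t : Space d} {B : Box d} {m : Tile d Γ}
    (h : (m.1 ∩ B.toSet).Nonempty) : ((m.shift t).1 ∩ (B.translate t).toSet).Nonempty := by
  obtain ⟨p, hp, hpB⟩ := h
  exact ⟨p + t, (Tile.mem_shift _ _ _).2 (by simpa using hp), (B.mem_translate t _).2 (by simpa using hpB)⟩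

/-- The patch of a pair of tiles in a box is determined by the pattern near the box. -/
theorem UniformTiling.samePatch (hS : UniformTiling ρ D S) (hS' : UniformTiling ρ D S')
    (hρ : 0 < ρ) (hD : 0 ≤ D) {R : ℝ} (hR : 0 ≤ R) {B : Box d} {t : Space d}
    (h : ∀ m ∈ S, (m.1 ∩ (B.grow (R + 1 + 2 * D) (by linarith)).toSet).Nonempty → m.shift t ∈ S')
    {x y : Tile d Γ} (hx : x ∈ S) (hy : y ∈ S) (hxB : (x.1 ∩ B.toSet).Nonempty)
    (hyB : (y.1 ∩ B.toSet).Nonempty) : SamePatch R S S' x y (x.shift t) (y.shift t) := by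
  have hE : 0 ≤ R + 1 + 2 * D := by linarith
  have hmem : ∀ x ∈ S, (x.1 ∩ B.toSet).Nonempty → x.shift t ∈ S' := fun x hx hxB =>
    h x hx (hxB.mono (Set.inter_subset_inter_right _ (B.subset_grow hE)))
  have hfwd : ∀ x ∈ S, (x.1 ∩ B.toSet).Nonempty → ∀ m ∈ S, tileDist m x ≤ R → m.shift t ∈ S' := by
    intro x hx hxB m hm hmx
    obtain ⟨p, hp⟩ := nonempty_of_homeomorph (hS.isTiling.1.1 m hm)
    exact h m hm ⟨p, hp, hS.subset_grow_of_tileDist_le hD hR hx hm hxB hmx hp⟩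
  -- The patch in `S'` has no further tiles, since the translated pattern already fills the region.
  have hbwd : ∀ x ∈ S, (x.1 ∩ B.toSet).Nonempty → ∀ z ∈ S', tileDist z (x.shift t) ≤ R →
      ∃ m ∈ S, m.shift t = z := by
    intro x hx hxB z hz hzx
    refine hS.exists_shift_eq hS' hρ hD h hz fun p hp => ?_
    have := hS'.subset_grow_of_tileDist_le hD hR (hmem x hx hxB) hz
      (inter_translate_nonempty hxB) hzx hp
    intro j
    have := this j
    simp only [Box.grow, Box.translate, PiLp.sub_apply] at this ⊢
    constructor <;> linarith
  refine ⟨t, rfl, rfl, Set.Subset.antisymm ?_ ?_⟩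
  · rintro _ ⟨m, ⟨hm, hd⟩, rfl⟩
    refine ⟨hd.elim (hfwd x hx hxB m hm) (hfwd y hy hyB m hm), ?_⟩
    simpa only [tileDist_shift] using hd
  · rintro z ⟨hz, hd⟩
    obtain ⟨m, hm, rfl⟩ := hd.elim (hbwd x hx hxB z hz) (hbwd y hy hyB z hz)
    exact ⟨m, ⟨hm, by simpa only [tileDist_shift] using hd⟩, rfl⟩

/-- The eigenvalue count in a box is determined by the pattern near the box. -/
theorem UniformTiling.kernelCount_translate (hS : UniformTiling ρ D S)
    (hS' : UniformTiling ρ D S') (hρ : 0 < ρ) (hD : 0 ≤ D) {R : ℝ} (hR : 0 ≤ R)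
    {T : Set (Tile d Γ)} {A : L2 T →L[ℂ] L2 T} (hI : PatternInvariant A R) (lam : ℝ) {B : Box d}
    {t : Space d}
    (h : ∀ m ∈ S, (m.1 ∩ (B.grow (R + 1 + 2 * D) (by linarith)).toSet).Nonempty → m.shift t ∈ S') :
    kernelCount (manifestation A R S') lam (boxTiles S' (B.translate t)) =
      kernelCount (manifestation A R S) lam (boxTiles S B) := by
  have hE : 0 ≤ R + 1 + 2 * D := by linarith
  have hmeet : ∀ x ∈ boxTiles S B, (x.1.1 ∩ B.toSet).Nonempty := fun x hx =>
    hx.mono (Set.inter_subset_inter_right _ interior_subset)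
  have hmem : ∀ x ∈ boxTiles S B, x.1.shift t ∈ S' := fun x hx =>
    h x.1 x.2 ((hmeet x hx).mono (Set.inter_subset_inter_right _ (B.subset_grow hE)))
  have hbox : ∀ m : Tile d Γ, (m.1 ∩ interior B.toSet).Nonempty ↔
      ((m.shift t).1 ∩ interior (B.translate t).toSet).Nonempty := by
    intro m
    constructor
    · rintro ⟨p, hp, hpB⟩
      exact ⟨p + t, (Tile.mem_shift _ _ _).2 (by simpa using hp),
        (B.mem_interior_translate t _).2 (by simpa using hpB)⟩
    · rintro ⟨p, hp, hpB⟩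
      exact ⟨p - t, (Tile.mem_shift _ _ _).1 hp, (B.mem_interior_translate t _).1 hpB⟩
  let f : boxTiles S B → boxTiles S' (B.translate t) := fun x =>
    ⟨⟨x.1.1.shift t, hmem x.1 x.2⟩, (hbox x.1.1).1 x.2⟩
  have hf : Function.Bijective f := by
    constructor
    · intro x y hxy
      exact Subtype.ext (Subtype.ext (Tile.shift_injective t
        (congrArg (fun z : boxTiles S' (B.translate t) => z.1.1) hxy)))
    · rintro ⟨⟨z, hz⟩, hzB⟩
      obtain ⟨m, hm, rfl⟩ := hS.exists_shift_eq hS' hρ hD h hz fun p hp j => by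
        have := hS'.subset_of_mem_boxTiles hD hzB hp j
        simp only [Box.grow, Box.translate, PiLp.sub_apply] at this ⊢
        constructor <;> linarith
      exact ⟨⟨⟨m, hm⟩, (hbox m).2 hzB⟩, rfl⟩
  refine (eigenvalueCount_reindex (Equiv.ofBijective f hf) _ _ (fun x y => ?_) lam).symm
  exact manifestation_congr hI (hS.samePatch hS' hρ hD hR h x.1.2 y.1.2 (hmeet _ x.2) (hmeet _ y.2))

theorem AbstractPattern.Contained.exists_shift {M N : Pattern d Γ}
    (h : AbstractPattern.Contained (⟦M⟧ : AbstractPattern d Γ) ⟦N⟧) :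
    ∃ t, shiftSet t M.1 ⊆ N.1 := by
  obtain ⟨M', N', hM, hN, hsub⟩ := h
  obtain ⟨t, ht⟩ := Quotient.exact hM.symm
  obtain ⟨u, hu⟩ := Quotient.exact hN
  refine ⟨t + u, ?_⟩
  rw [← shiftSet_shiftSet, ht, ← hu]
  exact Set.image_mono hsub

/-- In a linearly repetitive situation, the pattern near a box has a copy deep inside of every
proportionally larger box. -/
theorem exists_copy_inside (hd : 0 < d) {Ps : Set (AbstractPattern d Γ)} {c : ℝ} (hc : 0 < c)
    (hrep : ∀ M N : Pattern d Γ, ⟦M⟧ ∈ Ps → ⟦N⟧ ∈ Ps → 1 ≤ outerRadius (support M.1) →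
      c * outerRadius (support M.1) ≤ innerRadius (support N.1) →
        AbstractPattern.Contained (⟦M⟧ : AbstractPattern d Γ) ⟦N⟧)
    (hmem : S ∈ tilingSpace Ps) (hmem' : S' ∈ tilingSpace Ps)
    (hS : UniformTiling ρ D S) (hS' : UniformTiling ρ D S') (hρ : 0 < ρ) (hD : 0 ≤ D) {E : ℝ}
    (hE : 0 ≤ E) {L : ℝ} (hL : E + D + 2 ≤ L) {B₀ : Box d}
    (hB₀ : ∀ j, L ≤ B₀.side j ∧ B₀.side j < 2 * L) {B : Box d}
    (hB : ∀ j, (4 + 4 * c * d) * L ≤ B.side j) :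
    ∃ t, (∀ m ∈ S, (m.1 ∩ (B₀.grow E hE).toSet).Nonempty → m.shift t ∈ S') ∧
      (∀ j, B.lower j + L ≤ (B₀.translate t).lower j) ∧
      (∀ j, (B₀.translate t).upper j + L ≤ B.upper j) := by
  have hL2 : 2 ≤ L := by linarith
  have hcdL : 0 ≤ c * (d * (2 * L)) := by positivity
  have hside : ∀ j, 2 * L + 2 * L + 2 * (c * (d * (2 * L))) ≤ B.upper j - B.lower j := fun j => by
    have := hB j
    rw [Box.side] at this
    linarith
  -- Using only tiles inside `Q` for the large pattern forces every copy found there to stay at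
  -- distance `L` from the faces of `B`.
  let Q : Box d := ⟨fun j => B.lower j + L, fun j => B.upper j - L, fun j => by linarith [hside j]⟩
  have hMfin := hS.finite_meeting hρ hD (B₀.grow E hE)
  set Mset := {m ∈ S | (m.1 ∩ (B₀.grow E hE).toSet).Nonempty} with hMset
  let Nset := {m ∈ S' | m.1 ⊆ Q.toSet}
  have hNfin : Nset.Finite := by
    have := hS'.finite_of_subset hρ (Q := Q) (X := {x : S' | x.1.1 ⊆ Q.toSet}) fun x hx => hx
    refine (this.image Subtype.val).subset ?_
    rintro m ⟨hm, hmQ⟩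
    exact ⟨⟨m, hm⟩, hmQ, rfl⟩
  have hMS : Mset ⊆ S := Set.sep_subset _ _
  have hNS : Nset ⊆ S' := Set.sep_subset _ _
  let M : Pattern d Γ := ⟨Mset, hMfin, hS.isTiling.1.mono hMS⟩
  let N : Pattern d Γ := ⟨Nset, hNfin, hS'.isTiling.1.mono hNS⟩
  have hB₀M : B₀.toSet ⊆ support Mset := fun p hp => by
    obtain ⟨m, hm, hpm⟩ := hS.exists_mem p
    exact Set.mem_iUnion₂.2 ⟨m, ⟨hm, p, hpm, B₀.subset_grow hE hp⟩, hpm⟩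
  have hNQ : support Nset ⊆ Q.toSet := Set.iUnion₂_subset fun m hm => hm.2
  have hl₀ : WithLp.toLp 2 B₀.lower ∈ B₀.toSet := fun j => ⟨le_rfl, (B₀.lower_lt_upper j).le⟩
  have hu₀ : WithLp.toLp 2 B₀.upper ∈ B₀.toSet := fun j => ⟨(B₀.lower_lt_upper j).le, le_rfl⟩
  -- The support lies in `B₀` grown by `E + D ≤ L`, whose sides are below `4 * L`.
  have hMball : support Mset ⊆
      Metric.closedBall ((B₀.grow E hE).grow D hD).center (d * (2 * L)) := by
    refine Set.Subset.trans ?_ (Box.subset_closedBall _ (by linarith) fun j => ?_)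
    · exact Set.iUnion₂_subset fun m hm => hS.subset_grow hD hm.1 hm.2
    · rw [Box.side_grow, Box.side_grow]
      linarith [(hB₀ j).2]
  have hMout : outerRadius (support Mset) ≤ d * (2 * L) := by
    refine csInf_le ⟨0, ?_⟩ ⟨_, hMball⟩
    rintro r ⟨x, hx⟩
    exact dist_nonneg.trans (Metric.mem_closedBall.1 (hx (hB₀M hl₀)))
  have hMone : 1 ≤ outerRadius (support Mset) := by
    refine le_csInf ⟨_, _, hMball⟩ ?_
    rintro r ⟨x, hx⟩
    have h₁ := Metric.mem_closedBall'.1 (hx (hB₀M hl₀))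
    have h₂ := Metric.mem_closedBall.1 (hx (hB₀M hu₀))
    have h₃ := (abs_le.1 (abs_coord_sub_le (WithLp.toLp 2 B₀.upper) (WithLp.toLp 2 B₀.lower)
      ⟨0, hd⟩)).2
    have h₄ := (hB₀ ⟨0, hd⟩).1
    rw [Box.side] at h₄
    linarith [dist_triangle (WithLp.toLp 2 B₀.upper) x (WithLp.toLp 2 B₀.lower)]
  -- Every tile that meets the ball of this radius around the centre of `B` lies in `Q`: half a side
  -- of `B` is at least `2 * L` plus the radius, which leaves room for the margin `L` and the
  -- diameter `D ≤ L`. This fixes the factor `4 + 4 * c * d`.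
  have hNin : c * (d * (2 * L)) ≤ innerRadius (support Nset) := by
    refine le_csSup ⟨B.upper ⟨0, hd⟩ - B.lower ⟨0, hd⟩, ?_⟩ ⟨B.center, ?_⟩
    · rintro r ⟨x, hx⟩
      rcases lt_or_ge r 0 with hr | hr
      · linarith [B.lower_lt_upper ⟨0, hd⟩]
      · have h₁ := hNQ (hx (Metric.mem_closedBall_self hr)) ⟨0, hd⟩
        have h₂ := hNQ (hx (show x + EuclideanSpace.single ⟨0, hd⟩ r ∈ Metric.closedBall x r by
          simp [abs_of_nonneg hr])) ⟨0, hd⟩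
        simp only [Q, PiLp.add_apply, PiLp.single_apply, if_true] at h₁ h₂
        linarith
    · intro p hp
      obtain ⟨m, hm, hpm⟩ := hS'.exists_mem p
      refine Set.mem_iUnion₂.2 ⟨m, ⟨hm, fun q hq j => ?_⟩, hpm⟩
      have h₁ := abs_le.1 ((abs_coord_sub_le p B.center j).trans (Metric.mem_closedBall.1 hp))
      have h₂ := abs_le.1 ((abs_coord_sub_le q p j).trans (hS'.dist_le m hm q hq p hpm))
      have h₃ := hside j
      simp only [Q, Box.center] at h₁ ⊢
      constructor <;> linarith
  obtain ⟨t, ht⟩ := (hrep M N (hmem.2 ⟨M, hMS, rfl⟩) (hmem'.2 ⟨N, hNS, rfl⟩) hMone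
    ((mul_le_mul_of_nonneg_left hMout hc.le).trans hNin)).exists_shift
  have hQ : ∀ p ∈ B₀.toSet, p + t ∈ Q.toSet := fun p hp => by
    obtain ⟨m, hm, hpm⟩ := Set.mem_iUnion₂.1 (hB₀M hp)
    exact hNQ (Set.mem_iUnion₂.2 ⟨m.shift t, ht ⟨m, hm, rfl⟩, p, hpm, rfl⟩)
  refine ⟨t, fun m hm hmB => hNS (ht ⟨m, ⟨hm, hmB⟩, rfl⟩), fun j => ?_, fun j => ?_⟩
  · exact (hQ _ hl₀ j).1
  · have := (hQ _ hu₀ j).2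
    simp only [Q, PiLp.add_apply] at this
    simp only [Box.translate]
    linarith

end Translation

end LRTiling
end

/-! ### Uniform convergence of the normalized eigenvalue counts. -/

theorem theorem5p1 {d : ℕ} (hd : 0 < d) {Γ : Type*}
    (T : Set (LRTiling.Tile d Γ)) (hT : LRTiling.IsTiling T)
    (hLR : LRTiling.IsLinearlyRepetitive (LRTiling.patternClasses T))
    (A : LRTiling.L2 T →L[ℂ] LRTiling.L2 T) (hA : IsSelfAdjoint A)
    (R : ℝ) (hR : 0 ≤ R)
    (hFR : LRTiling.FiniteRange A R) (hI : LRTiling.PatternInvariant A R) (lam : ℝ) :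
    ∃ N : ℝ, TendstoUniformlyOn
      (fun (B : LRTiling.Box d) (S : Set (LRTiling.Tile d Γ)) =>
        LRTiling.countingFunction A R lam S B)
      (fun _ => N) (Filter.comap LRTiling.Box.width Filter.atTop)
      (LRTiling.tilingSpace (LRTiling.patternClasses T)) := by
  open LRTiling in
  obtain ⟨hadm, c, hc, hrep⟩ := hLR
  obtain ⟨ρ, D, hρ, hD, hunif⟩ := hadm.exists_uniform
  have hv := ballVol_pos (d := d) hρ
  have hE : 0 ≤ R + 1 + 2 * D := by linarith
  obtain ⟨N, hN⟩ := exists_uniform_mean (Ω := tilingSpace (patternClasses T))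
    ⟨T, hT, subset_rfl⟩
    (fun S B => (kernelCount (manifestation A R S) lam (boxTiles S B) : ℝ))
    (C₀ := (1 + 2 * D) ^ d / ballVol d ρ)
    (C := 3 * (2 * (R + D) * (1 + 2 * D) ^ d / ballVol d ρ))
    (K := 4 + 4 * c * d) (L₀ := R + 1 + 2 * D + D + 2) (by positivity)
    (by have : 0 ≤ 4 * c * d := by positivity
        linarith)
    (fun S _ B => Nat.cast_nonneg _)
    (fun S hS B hB => (hunif S hS).kernelCount_boxTiles_le hρ hD.le (manifestation_star hA hI)
      lam hB)
    (fun S hS B j b h₁ h₂ hB => (hunif S hS).abs_kernelCount_cut_le hρ hD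
      (manifestation_star hA hI) hR (manifestation_eq_zero hFR hI) lam B j b h₁ h₂ hB)
    (fun L hL S hS B₀ hB₀ S' hS' B hB => by
      obtain ⟨t, ht, hl, hu⟩ := exists_copy_inside hd hc hrep hS hS' (hunif S hS) (hunif S' hS')
        hρ hD.le hE hL hB₀ hB
      exact ⟨B₀.translate t, B₀.side_translate t, hl, hu, congrArg Nat.cast
        ((hunif S hS).kernelCount_translate (hunif S' hS') hρ hD.le hR hI lam ht)⟩)
  refine ⟨N, Metric.tendstoUniformlyOn_iff.2 fun ε hε => ?_⟩
  obtain ⟨r, hr⟩ := hN ε hε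
  filter_upwards [Filter.preimage_mem_comap (Filter.Ici_mem_atTop r)] with B hB S hS
  rw [dist_comm, Real.dist_eq]
  -- `countingFunction` unfolds definitionally to the normalized `kernelCount` of `boxTiles`.
  exact hr S hS B fun j => (Set.mem_Ici.1 hB).trans
    (ciInf_le (Set.finite_range fun j => B.upper j - B.lower j).bddBelow j)
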